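/- \textbf{Definitions.} All tiles are congruent rhombi of side length $1$ with angles $60^\circ$ and $120^\circ$. Let $\mathcal T$ be a finite non-empty set of tiles in the plane such that any two different tiles are disjoint, or have exactly one vertex in common, or have exactly one full side in common. Two different tiles are \emph{adjacent} if they have a side in common, and \emph{neighbours} if they have at least a vertex in common. A \emph{run} of $\mathcal T$ is a maximal sequence of at least two different tiles of $\mathcal T$ in which any two consecutive tiles have a side in common and all these common sides are parallel to each other (a sequence and its reversal are the same run). A \emph{leaf} of $\mathcal T$ is a tile of $\mathcal T$ that is adjacent to exactly one other tile of $\mathcal T$. For a natural number $\kappa$, $\mathcal T$ is a \emph{$\kappa$-doku tiling} if (1) any two tiles of $\mathcal T$ are linked by a chain of tiles of $\mathcal T$ in which consecutive tiles are adjacent; (2) after the removal of any one tile, any two remaining tiles are linked by a chain of remaining tiles in which consecutive tiles are neighbours; (3) every run of $\mathcal T$ consists of exactly $\kappa$ tiles; (4) $\mathcal T$ has no holes, that is, the complement in the plane of the union of its (closed) tiles is connected. By (1), such a tiling lies, after an isometry, on the triangular lattice of side length $1$, so we may take the vertices of all tiles to be lattice points. \textbf{Proposition.} Let $\kappa$ be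 a natural number. A $\kappa$-doku tiling with $\rho$ runs has at most $\rho+3$ leaves. -/

import Mathlib

/-!
Lozenge tilings are placed on the triangular lattice.  The pair `(x, y) : ℤ × ℤ` stands for the point
`x + y * exp (π * I / 3)` of the complex plane.  A patch of unit `60°/120°` rhombi which is connected
through full common sides lies, after an isometry, on this lattice, and it uses only the three
orientations of a rhombus that occur below.
-/

namespace Doku

/-- The three side directions: the unit vectors at the angles `0°`, `60°` and `120°`. -/
def step : Fin 3 → ℤ × ℤ := ![(1, 0), (0, 1), (-1, 1)]

/-- A tile: the unit rhombus with corner `base`, spanned by the directions `kind` and `kind + 1`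
(modulo `3`).  Every unit rhombus with vertices and sides in the lattice is obtained exactly once. -/
@[ext]
structure Lozenge where
  base : ℤ × ℤ
  kind : Fin 3
deriving DecidableEq

namespace Lozenge

/-- The four corners of a tile. -/
def vertices (t : Lozenge) : Finset (ℤ × ℤ) :=
  {t.base, t.base + step t.kind, t.base + step (t.kind + 1),
    t.base + step t.kind + step (t.kind + 1)}

/-- The four sides of a tile.  The pair `(p, d)` stands for the segment from `p` to `p + step d`. -/
def sides (t : Lozenge) : Finset ((ℤ × ℤ) × Fin 3) :=
  {(t.base, t.kind), (t.base + step (t.kind + 1), t.kind),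
    (t.base, t.kind + 1), (t.base + step t.kind, t.kind + 1)}

end Lozenge

/-- The unit triangles of the lattice, pointing up (`true`) or down (`false`). -/
abbrev Triangle := (ℤ × ℤ) × Bool

/-- The three corners of a unit triangle. -/
def Triangle.vertices (δ : Triangle) : Finset (ℤ × ℤ) :=
  if δ.2 then {δ.1, δ.1 + step 0, δ.1 + step 1}
  else {δ.1 + step 0, δ.1 + step 1, δ.1 + step 0 + step 1}

/-- The tile `t` contains the unit triangle `δ` (each tile is the union of two of them). -/
def Covers (t : Lozenge) (δ : Triangle) : Prop := δ.vertices ⊆ t.vertices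

/-- The dual graph of a set of tiles: distinct tiles are adjacent if they have a side in common. -/
def dualGraph (T : Finset Lozenge) : SimpleGraph T :=
  SimpleGraph.fromRel fun s t => ∃ e, e ∈ s.1.sides ∧ e ∈ t.1.sides

/-- The neighbour dual graph: distinct tiles are joined if they touch, that is, if they have at least
a vertex in common. -/
def neighbourGraph (T : Finset Lozenge) : SimpleGraph T :=
  SimpleGraph.fromRel fun s t => ∃ p, p ∈ s.1.vertices ∧ p ∈ t.1.vertices

/-- Distinct tiles are joined if they have a side of direction `d` in common. -/
def parallelGraph (T : Finset Lozenge) (d : Fin 3) : SimpleGraph T :=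
  SimpleGraph.fromRel fun s t => ∃ p, (p, d) ∈ s.1.sides ∧ (p, d) ∈ t.1.sides

/-- The runs: the maximal sequences of at least two tiles in which consecutive tiles have a side in
common and all of these common sides are parallel to one direction `d`.  As a set of tiles, such a
sequence is a connected component of `parallelGraph T d`, because a tile has at most two sides of
direction `d`, one opposite to the other. -/
def runs (T : Finset Lozenge) : Set (Set Lozenge) :=
  {R | 2 ≤ R.ncard ∧
    ∃ (d : Fin 3) (c : (parallelGraph T d).ConnectedComponent), R = Subtype.val '' c.supp}

/-- The leaves: the tiles adjacent to exactly one other tile. -/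
def leaves (T : Finset Lozenge) : Set T := {t | ∃! s, (dualGraph T).Adj t s}

/-- Two unit triangles are joined if they have a side in common. -/
def triangleGraph : SimpleGraph Triangle :=
  SimpleGraph.fromRel fun δ ε => (δ.vertices ∩ ε.vertices).card = 2

/-- The region covered by `T` has no holes: its complement in the plane is connected.  The complement
is open; it consists of the interiors of the uncovered triangles, the interiors of those sides which
lie between two uncovered triangles, and the vertices all of whose six triangles are uncovered.  So it
is connected if and only if any two uncovered triangles are linked by a chain of uncovered triangles
with common sides. -/
def NoHoles (T : Finset Lozenge) : Prop :=
  (triangleGraph.induce {δ | ∀ t ∈ T, ¬ Covers t δ}).Preconnected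

/-- `κ`-doku tilings: finite sets of tiles, without holes, all of whose runs have length `κ`. -/
structure IsDokuTiling (κ : ℕ) (T : Finset Lozenge) : Prop where
  /-- Different tiles do not overlap; so, on the lattice, two tiles that touch have either just
  a vertex or a full side in common. -/
  nonoverlapping : ∀ s ∈ T, ∀ t ∈ T, ∀ δ : Triangle, Covers s δ → Covers t δ → s = t
  /-- The tiling is connected through common sides. -/
  connected : (dualGraph T).Connected
  /-- Removing one tile does not disconnect the tiling, where now a common vertex counts as
  a connection. -/
  robust : ∀ t ∈ T, (neighbourGraph (T.erase t)).Preconnected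
  /-- Every run consists of exactly `κ` tiles. -/
  run_length : ∀ R ∈ runs T, R.ncard = κ
  noHoles : NoHoles T

end Doku

/-! Write `n`, `σ`, `ℓ` and `ρ` for the numbers of tiles, of sides shared by two tiles, of leaves
and of runs. The bound is the sum of two estimates: `2ℓ ≤ 2n - σ + 3` and `2n - σ ≤ ρ + ℓ`.

The second one counts strips. For each direction `d` the tiles split into strips held together by
shared sides of direction `d`, and a connected strip with `m` tiles needs at least `m - 1` of these
(`IsPacking.card_le_card_strips`). Over the three directions this gives `3n ≤ σ +` the number of
strips. A strip of several tiles is a run. A strip of one tile is a tile isolated along `d`: this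
happens once for each tile, in the direction in which it has no sides, and otherwise only for
leaves, at most once each (`IsDokuTiling.sum_card_isolated_le`). So there are at most `ρ + n + ℓ`
strips.

The first one follows the boundary, whose length is `b = 2 * |allSides| - 4n ≤ 4n - 2σ`, and amounts
to `4ℓ ≤ b + 6` (`four_mul_card_teeth_le`). A maximal gap of `g` consecutive uncovered sectors at a
boundary vertex turns the boundary by `(g - 3) * 60°`. There are `b` gaps, and since the Euler
characteristic of a connected region is at most one, the sum of `g - 3` is at most `6`. A leaf has
gaps `g = 5` and `g = 4` at its two free corners. The turning lost at notches (`g = 1`) is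
controlled by the absence of holes: every notch forces a gap `g ≥ 3` of its own, and each leaf still
has one such gap to spare.

That both outer corners of a leaf are free comes from the robustness of the tiling. The Euler
characteristic is at most one after the removal of a tile and, by planar duality (`card_edges_lt`),
at least one before; so a tile has at most one more side than corner of its own
(`IsDokuTiling.card_own_sides_le`). The same estimate shows that a tile isolated along one of its
own directions is a leaf. -/

namespace Doku

open Relation

/-! ### Counting nodes, edges and faces of abstract graphs -/

section Graphs

variable {α β F : Type*}

/-- Two nodes are joined if they are the ends `s e`, `t e` of an edge `e` of `E`. -/
def Joined (s t : β → α) (E : Finset β) (x y : α) : Prop := ∃ e ∈ E, s e = x ∧ t e = y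

theorem eqvGen_joined_mono {s t : β → α} {E E' : Finset β} (h : E ⊆ E') {a b : α}
    (hab : EqvGen (Joined s t E) a b) : EqvGen (Joined s t E') a b :=
  hab.mono fun _ _ ⟨e, he, h'⟩ => ⟨e, h he, h'⟩

/-- Induction by contracting an edge: moving `t e` onto `s e` keeps everything linked and loses at
most one node. The maps `s` and `t` vary in the induction because contraction changes the ends of
the remaining edges. -/
theorem card_le_card_edges_add_one [DecidableEq α] [DecidableEq β] (E : Finset β) :
    ∀ (s t : β → α) (V : Finset α),
      (∀ a ∈ V, ∀ b ∈ V, EqvGen (Joined s t E) a b) → V.card ≤ E.card + 1 := by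
  induction E using Finset.induction_on with
  | empty =>
    intro s t V h
    have key : ∀ a b, EqvGen (Joined s t (∅ : Finset β)) a b → a = b := by
      intro a b hab
      induction hab with
      | rel x y h => obtain ⟨e, he, -⟩ := h; simp at he
      | refl x => rfl
      | symm x y _ ih => exact ih.symm
      | trans x y z _ _ h1 h2 => exact h1.trans h2
    simpa using Finset.card_le_one.2 fun a ha b hb => key a b (h a ha b hb)
  | insert e E he ih =>
    intro s t V h
    let φ : α → α := fun x => if x = t e then s e else x
    have hφ : φ (s e) = φ (t e) := by simp only [φ]; split_ifs <;> rfl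
    have key : ∀ a b, EqvGen (Joined s t (insert e E)) a b →
        EqvGen (Joined (φ ∘ s) (φ ∘ t) E) (φ a) (φ b) := by
      intro a b hab
      induction hab with
      | rel x y h =>
        obtain ⟨e', he', rfl, rfl⟩ := h
        rcases Finset.mem_insert.1 he' with rfl | h'
        · rw [hφ]; exact EqvGen.refl _
        · exact EqvGen.rel _ _ ⟨e', h', rfl, rfl⟩
      | refl x => exact EqvGen.refl _
      | symm x y _ ih => exact ih.symm
      | trans x y z _ _ h1 h2 => exact h1.trans _ _ _ h2
    have h1 := ih (φ ∘ s) (φ ∘ t) (V.image φ) (by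
      intro a ha b hb
      obtain ⟨a', ha', rfl⟩ := Finset.mem_image.1 ha
      obtain ⟨b', hb', rfl⟩ := Finset.mem_image.1 hb
      exact key a' b' (h a' ha' b' hb'))
    have h2 : V.erase (t e) ⊆ V.image φ := by
      intro x hx
      rw [Finset.mem_erase] at hx
      exact Finset.mem_image.2 ⟨x, hx.2, by simp [φ, hx.1]⟩
    have h3 := Finset.card_le_card h2
    have h4 := Finset.pred_card_le_card_erase (s := V) (a := t e)
    rw [Finset.card_insert_of_notMem he]
    omega

/-- Nodes in the same class are linked by edges. -/
theorem card_le_card_edges_add_card_classes {γ : Type*} [DecidableEq α] [DecidableEq β]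
    [DecidableEq γ] (E : Finset β) (s t : β → α) (V : Finset α) (cl : α → γ)
    (h : ∀ a ∈ V, ∀ b ∈ V, cl a = cl b → EqvGen (Joined s t E) a b) :
    V.card ≤ E.card + (V.image cl).card := by
  have hrep : ∀ c : γ, ∃ a : Option α, c ∈ V.image cl → ∃ x ∈ V, a = some x ∧ cl x = c := by
    intro c
    by_cases hc : c ∈ V.image cl
    · obtain ⟨x, hx, rfl⟩ := Finset.mem_image.1 hc
      exact ⟨some x, fun _ => ⟨x, hx, rfl, rfl⟩⟩
    · exact ⟨none, fun h => absurd h hc⟩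
  choose rep hrep using hrep
  -- An extra node `none`, joined to one representative of each class, makes the graph connected at
  -- the price of one node and one edge per class.
  let s' : β ⊕ γ → Option α := Sum.elim (fun e => some (s e)) (fun _ => none)
  let t' : β ⊕ γ → Option α := Sum.elim (fun e => some (t e)) rep
  have lift : ∀ a b, EqvGen (Joined s t E) a b →
      EqvGen (Joined s' t' (E.disjSum (V.image cl))) (some a) (some b) := by
    intro a b hab
    induction hab with
    | rel x y h =>
      obtain ⟨e, he, rfl, rfl⟩ := h
      exact EqvGen.rel _ _ ⟨Sum.inl e, by simpa using he, rfl, rfl⟩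
    | refl x => exact EqvGen.refl _
    | symm x y _ ih => exact ih.symm
    | trans x y z _ _ h1 h2 => exact h1.trans _ _ _ h2
  have toNone : ∀ a ∈ Finset.insertNone V,
      EqvGen (Joined s' t' (E.disjSum (V.image cl))) none a := by
    intro a ha
    cases a with
    | none => exact EqvGen.refl _
    | some a =>
      have ha : a ∈ V := by simpa using ha
      have hc := Finset.mem_image_of_mem cl ha
      obtain ⟨x, hx, h1, h2⟩ := hrep _ hc
      refine EqvGen.trans _ (some x) _ ?_ (lift _ _ (h x hx a ha h2))
      exact EqvGen.rel _ _ ⟨Sum.inr (cl a), by simpa using hc, rfl, h1⟩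
  have := card_le_card_edges_add_one (E.disjSum (V.image cl)) s' t' (Finset.insertNone V)
    fun a ha b hb => (toNone a ha).symm.trans _ _ _ (toNone b hb)
  rw [Finset.card_disjSum, Finset.card_insertNone] at this
  omega

/-- If moreover every face `f` is bounded by a cycle of edges, and every non-empty set of faces has
a free edge, then one edge per face can be removed without disconnecting the nodes. -/
theorem card_add_card_faces_le [DecidableEq α] [DecidableEq β] [DecidableEq F]
    (s t : β → α) (bd : F → Finset β) (V : Finset α) :
    ∀ (n : ℕ) (S : Finset F) (E : Finset β), S.card = n →
      (∀ f ∈ S, bd f ⊆ E) →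
      (∀ f ∈ S, ∀ e ∈ bd f, EqvGen (Joined s t ((bd f).erase e)) (s e) (t e)) →
      (∀ S' ⊆ S, S'.Nonempty → ∃ f ∈ S', ∃ e ∈ bd f, ∀ g ∈ S', g ≠ f → e ∉ bd g) →
      (∀ a ∈ V, ∀ b ∈ V, EqvGen (Joined s t E) a b) →
      V.card + S.card ≤ E.card + 1 := by
  intro n
  induction n with
  | zero =>
    intro S E hS _ _ _ hV
    rw [hS]
    exact card_le_card_edges_add_one E s t V hV
  | succ n ih =>
    intro S E hS hsub hcyc hext hV
    obtain ⟨f, hf, e, he, hfree⟩ := hext S subset_rfl (Finset.card_pos.1 (by omega))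
    have heE : e ∈ E := hsub f hf he
    -- The edge `e` can be dropped because the rest of the cycle around `f` links its ends; as no
    -- other face uses `e`, the other cycles survive.
    have hstep : ∀ a b, EqvGen (Joined s t E) a b → EqvGen (Joined s t (E.erase e)) a b := by
      intro a b hab
      induction hab with
      | rel x y h =>
        obtain ⟨e', he', rfl, rfl⟩ := h
        by_cases h' : e' = e
        · subst h'
          exact eqvGen_joined_mono (Finset.erase_subset_erase _ (hsub f hf)) (hcyc f hf e' he)
        · exact EqvGen.rel _ _ ⟨e', Finset.mem_erase.2 ⟨h', he'⟩, rfl, rfl⟩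
      | refl x => exact EqvGen.refl _
      | symm x y _ ih => exact ih.symm
      | trans x y z _ _ h1 h2 => exact h1.trans _ _ _ h2
    have := ih (S.erase f) (E.erase e) (by rw [Finset.card_erase_of_mem hf]; omega)
      (fun g hg => by
        rw [Finset.mem_erase] at hg
        intro e' he'
        refine Finset.mem_erase.2 ⟨?_, hsub g hg.2 he'⟩
        rintro rfl
        exact hfree g hg.2 hg.1 he')
      (fun g hg => hcyc g (Finset.mem_of_mem_erase hg))
      (fun S' hS' => hext S' (hS'.trans (Finset.erase_subset _ _)))
      (fun a ha b hb => hstep a b (hV a ha b hb))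
    rw [Finset.card_erase_of_mem hf, Finset.card_erase_of_mem heE] at this
    have := Finset.card_pos.2 ⟨e, heE⟩
    omega

end Graphs

/-! ### Triangles, sectors and segments of the triangular lattice -/

/-- The six unit vectors of the lattice, counterclockwise. -/
def unitVec : Fin 6 → ℤ × ℤ := ![(1, 0), (0, 1), (-1, 1), (-1, 0), (0, -1), (1, -1)]

/-- The unit triangle with corners `v`, `v + unitVec i` and `v + unitVec (i + 1)`. -/
def sector (v : ℤ × ℤ) : Fin 6 → Triangle :=
  ![(v, true), (v + (-1, 0), false), (v + (-1, 0), true), (v + (-1, -1), false),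
    (v + (0, -1), true), (v + (0, -1), false)]

theorem unitVec_add_two (i : Fin 6) : unitVec i + unitVec (i + 2) = unitVec (i + 1) := by
  fin_cases i <;> rfl

theorem unitVec_add_three (i : Fin 6) : unitVec (i + 3) = -unitVec i := by
  fin_cases i <;> rfl

/-- A triangle is a sector at each of its three corners; going counterclockwise to the next corner
raises the index by two. -/
theorem sector_turn (v : ℤ × ℤ) (i : Fin 6) : sector (v + unitVec i) (i + 2) = sector v i := by
  obtain ⟨x, y⟩ := v
  fin_cases i <;> simp [sector, unitVec]

theorem sector_turn' (v : ℤ × ℤ) (i : Fin 6) :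
    sector (v + unitVec (i + 1)) (i + 4) = sector v i := by
  obtain ⟨x, y⟩ := v
  fin_cases i <;> simp [sector, unitVec]

/-- The triangle which shares with `sector v i` the side opposite to `v`. -/
def outer (v : ℤ × ℤ) (i : Fin 6) : Triangle := sector (v + unitVec i) (i + 1)

theorem outer_eq (v : ℤ × ℤ) (i : Fin 6) : outer v i = sector (v + unitVec (i + 1)) (i + 5) := by
  obtain ⟨x, y⟩ := v
  fin_cases i <;> simp [outer, sector, unitVec]

theorem vertices_true (p : ℤ × ℤ) : Triangle.vertices (p, true) = {p, p + (1, 0), p + (0, 1)} := rfl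

theorem vertices_false (p : ℤ × ℤ) :
    Triangle.vertices (p, false) = {p + (1, 0), p + (0, 1), p + (1, 1)} := by
  simp [Triangle.vertices, step, add_assoc]

theorem vertices_sector (v : ℤ × ℤ) (i : Fin 6) :
    (sector v i).vertices = {v, v + unitVec i, v + unitVec (i + 1)} := by
  obtain ⟨x, y⟩ := v
  fin_cases i <;> ext ⟨a, b⟩ <;>
    simp [sector, unitVec, vertices_true, vertices_false] <;> omega

theorem sector_injective (v : ℤ × ℤ) : Function.Injective (sector v) := by
  obtain ⟨x, y⟩ := v
  intro i j
  fin_cases i <;> fin_cases j <;> simp [sector]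

theorem mem_vertices_iff {v : ℤ × ℤ} {δ : Triangle} :
    v ∈ δ.vertices ↔ ∃ i, sector v i = δ := by
  constructor
  · obtain ⟨p, b⟩ := δ
    intro h
    cases b
    · rw [vertices_false] at h
      simp only [Finset.mem_insert, Finset.mem_singleton] at h
      rcases h with rfl | rfl | rfl
      · exact ⟨1, by simp [sector, add_assoc]⟩
      · exact ⟨5, by simp [sector, add_assoc]⟩
      · exact ⟨3, by simp [sector, add_assoc]⟩
    · rw [vertices_true] at h
      simp only [Finset.mem_insert, Finset.mem_singleton] at h
      rcases h with rfl | rfl | rfl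
      · exact ⟨0, by simp [sector]⟩
      · exact ⟨2, by simp [sector, add_assoc]⟩
      · exact ⟨4, by simp [sector, add_assoc]⟩
  · rintro ⟨i, rfl⟩
    rw [vertices_sector]
    simp

/-- The three sides of a unit triangle. -/
def Triangle.edges (δ : Triangle) : Finset ((ℤ × ℤ) × Fin 3) :=
  if δ.2 then {(δ.1, 0), (δ.1, 1), (δ.1 + (1, 0), 2)}
  else {(δ.1 + (0, 1), 0), (δ.1 + (1, 0), 1), (δ.1 + (1, 0), 2)}

theorem edges_true (p : ℤ × ℤ) :
    Triangle.edges (p, true) = {(p, 0), (p, 1), (p + (1, 0), 2)} := rfl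

theorem edges_false (p : ℤ × ℤ) :
    Triangle.edges (p, false) = {(p + (0, 1), 0), (p + (1, 0), 1), (p + (1, 0), 2)} := rfl

/-- The triangle pointing up which lies at a segment. -/
def upAt (e : (ℤ × ℤ) × Fin 3) : Triangle := (e.1 + ![(0, 0), (0, 0), (-1, 0)] e.2, true)

/-- The triangle pointing down which lies at a segment. -/
def downAt (e : (ℤ × ℤ) × Fin 3) : Triangle := (e.1 + ![(0, -1), (-1, 0), (-1, 0)] e.2, false)

theorem mem_edges_iff {δ : Triangle} {e : (ℤ × ℤ) × Fin 3} :
    e ∈ δ.edges ↔ δ = upAt e ∨ δ = downAt e := by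
  obtain ⟨⟨x, y⟩, b⟩ := δ
  obtain ⟨⟨a, c⟩, d⟩ := e
  cases b <;> fin_cases d <;> simp [edges_true, edges_false, upAt, downAt] <;> omega

/-- The end of a segment other than its starting point. -/
def tip (e : (ℤ × ℤ) × Fin 3) : ℤ × ℤ := e.1 + step e.2

theorem ends_mem_vertices {δ : Triangle} {e : (ℤ × ℤ) × Fin 3} (h : e ∈ δ.edges) :
    e.1 ∈ δ.vertices ∧ tip e ∈ δ.vertices := by
  obtain ⟨⟨x, y⟩, b⟩ := δ
  obtain ⟨⟨a, c⟩, d⟩ := e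
  cases b <;> fin_cases d <;>
    simp [edges_true, edges_false, vertices_true, vertices_false, tip, step] at h ⊢ <;> omega

theorem eqvGen_ends_erase {δ : Triangle} {e : (ℤ × ℤ) × Fin 3} (h : e ∈ δ.edges) :
    EqvGen (Joined Prod.fst tip (δ.edges.erase e)) e.1 (tip e) := by
  obtain ⟨p, b⟩ := δ
  have R : ∀ f ∈ (Triangle.edges (p, b)).erase e,
      EqvGen (Joined Prod.fst tip ((Triangle.edges (p, b)).erase e)) f.1 (tip f) :=
    fun f hf => EqvGen.rel _ _ ⟨f, hf, rfl, rfl⟩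
  generalize hG : (Triangle.edges (p, b)).erase e = G at R ⊢
  have hG' : ∀ f, f ∈ G ↔ f ≠ e ∧ f ∈ Triangle.edges (p, b) := by
    intro f; rw [← hG, Finset.mem_erase]
  cases b
  · rw [edges_false] at h hG'
    simp only [Finset.mem_insert, Finset.mem_singleton] at h hG'
    have R0 := R (p + (0, 1), 0)
    have R1 := R (p + (1, 0), 1)
    have R2 := R (p + (1, 0), 2)
    simp only [hG', tip, step] at R0 R1 R2 ⊢
    rcases h with rfl | rfl | rfl <;> simp [add_assoc] at R0 R1 R2 ⊢
    · exact R2.symm.trans _ _ _ R1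
    · exact R2.trans _ _ _ R0
    · exact R1.trans _ _ _ R0.symm
  · rw [edges_true] at h hG'
    simp only [Finset.mem_insert, Finset.mem_singleton] at h hG'
    have R0 := R (p, 0)
    have R1 := R (p, 1)
    have R2 := R (p + (1, 0), 2)
    simp only [hG', tip, step] at R0 R1 R2 ⊢
    rcases h with rfl | rfl | rfl <;> simp [add_assoc] at R0 R1 R2 ⊢
    · exact R1.trans _ _ _ R2.symm
    · exact R0.trans _ _ _ R2
    · exact R0.symm.trans _ _ _ R1

theorem eqvGen_of_mem_vertices {δ : Triangle} {a b : ℤ × ℤ} (ha : a ∈ δ.vertices)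
    (hb : b ∈ δ.vertices) : EqvGen (Joined Prod.fst tip δ.edges) a b := by
  obtain ⟨p, c⟩ := δ
  have R : ∀ f ∈ Triangle.edges (p, c),
      EqvGen (Joined Prod.fst tip (Triangle.edges (p, c))) f.1 (tip f) :=
    fun f hf => EqvGen.rel _ _ ⟨f, hf, rfl, rfl⟩
  generalize hG : Triangle.edges (p, c) = G at R ⊢
  cases c
  · rw [edges_false] at hG
    have R0 := R (p + (0, 1), 0) (by simp [← hG])
    have R2 := R (p + (1, 0), 2) (by simp [← hG])
    simp [tip, step, add_assoc] at R0 R2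
    have key : ∀ x ∈ Triangle.vertices (p, false), EqvGen (Joined Prod.fst tip G) (p + (0, 1)) x := by
      intro x hx
      rw [vertices_false] at hx
      simp only [Finset.mem_insert, Finset.mem_singleton] at hx
      rcases hx with rfl | rfl | rfl
      exacts [R2.symm, EqvGen.refl _, R0]
    exact (key a ha).symm.trans _ _ _ (key b hb)
  · rw [edges_true] at hG
    have R0 := R (p, 0) (by simp [← hG])
    have R1 := R (p, 1) (by simp [← hG])
    simp [tip, step] at R0 R1
    have key : ∀ x ∈ Triangle.vertices (p, true), EqvGen (Joined Prod.fst tip G) p x := by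
      intro x hx
      rw [vertices_true] at hx
      simp only [Finset.mem_insert, Finset.mem_singleton] at hx
      rcases hx with rfl | rfl | rfl
      exacts [EqvGen.refl _, R0, R1]
    exact (key a ha).symm.trans _ _ _ (key b hb)

/-! ### The Euler characteristic of a region -/

/-- The vertices of a region. -/
def verts (C : Finset Triangle) : Finset (ℤ × ℤ) := C.biUnion Triangle.vertices

/-- The sides of the triangles of a region. -/
def edges (C : Finset Triangle) : Finset ((ℤ × ℤ) × Fin 3) := C.biUnion Triangle.edges

theorem mem_verts {C : Finset Triangle} {v : ℤ × ℤ} : v ∈ verts C ↔ ∃ i, sector v i ∈ C := by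
  simp only [verts, Finset.mem_biUnion, mem_vertices_iff]
  constructor
  · rintro ⟨_, h, i, rfl⟩; exact ⟨i, h⟩
  · rintro ⟨i, h⟩; exact ⟨_, h, i, rfl⟩

theorem mem_edges {C : Finset Triangle} {e : (ℤ × ℤ) × Fin 3} :
    e ∈ edges C ↔ upAt e ∈ C ∨ downAt e ∈ C := by
  simp only [edges, Finset.mem_biUnion, mem_edges_iff]
  constructor
  · rintro ⟨δ, h, rfl | rfl⟩
    exacts [.inl h, .inr h]
  · rintro (h | h)
    exacts [⟨_, h, .inl rfl⟩, ⟨_, h, .inr rfl⟩]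

/-- The Euler characteristic of a connected region is at most one. -/
theorem card_verts_add_card_le (C : Finset Triangle)
    (hC : ∀ a ∈ verts C, ∀ b ∈ verts C, EqvGen (Joined Prod.fst tip (edges C)) a b) :
    (verts C).card + C.card ≤ (edges C).card + 1 := by
  refine card_add_card_faces_le Prod.fst tip Triangle.edges (verts C) _ C (edges C) rfl
    (fun f hf => Finset.subset_biUnion_of_mem _ hf) (fun f _ e he => eqvGen_ends_erase he) ?_ hC
  intro S _ hS
  -- The weight is the sum of all coordinates of the three corners. Across a suitable side of a
  -- triangle of maximal weight lies a heavier triangle, so that side is free.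
  obtain ⟨δ, hδ, hmax⟩ := Finset.exists_max_image S
    (fun δ : Triangle => 3 * (δ.1.1 + δ.1.2) + if δ.2 then 2 else 4) hS
  refine ⟨δ, hδ, ?_⟩
  obtain ⟨⟨x, y⟩, b⟩ := δ
  cases b
  · refine ⟨((x, y) + (0, 1), 0), by simp [edges_false], fun g hg hne he => ?_⟩
    rcases mem_edges_iff.1 he with rfl | rfl
    · have := hmax _ hg
      simp [upAt] at this
      omega
    · simp [downAt] at hne
  · refine ⟨((x, y) + (1, 0), 2), by simp [edges_true], fun g hg hne he => ?_⟩
    rcases mem_edges_iff.1 he with rfl | rfl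
    · simp [upAt] at hne
    · have := hmax _ hg
      simp [downAt] at this

/-- Adjacent unit triangles lie at a common segment. -/
theorem exists_common_edge {δ ε : Triangle} (h : triangleGraph.Adj δ ε) :
    ∃ e, (δ = upAt e ∧ ε = downAt e) ∨ (ε = upAt e ∧ δ = downAt e) := by
  rw [triangleGraph, SimpleGraph.fromRel_adj, Finset.inter_comm ε.vertices, or_self] at h
  obtain ⟨hne, hcard⟩ := h
  obtain ⟨a, b, hab, hset⟩ := Finset.card_eq_two.1 hcard
  have ha : a ∈ δ.vertices ∩ ε.vertices := by simp [hset]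
  have hb : b ∈ δ.vertices ∩ ε.vertices := by simp [hset]
  rw [Finset.mem_inter] at ha hb
  clear hcard hset
  have key : ∀ p q : ℤ × ℤ, a ∈ Triangle.vertices (p, true) → a ∈ Triangle.vertices (q, false) →
      b ∈ Triangle.vertices (p, true) → b ∈ Triangle.vertices (q, false) →
      ∃ e, (p, true) = upAt e ∧ (q, false) = downAt e := by
    rintro ⟨x, y⟩ ⟨z, w⟩ h1 h2 h3 h4
    obtain ⟨a1, a2⟩ := a
    obtain ⟨b1, b2⟩ := b
    have : (x = z ∧ y = w) ∨ (x = z ∧ y = w + 1) ∨ (x = z + 1 ∧ y = w) := by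
      simp [vertices_true, vertices_false] at h1 h2 h3 h4 hab
      omega
    rcases this with ⟨rfl, rfl⟩ | ⟨rfl, rfl⟩ | ⟨rfl, rfl⟩
    · exact ⟨((x + 1, y), 2), by simp [upAt], by simp [downAt]⟩
    · exact ⟨((x, w + 1), 0), by simp [upAt], by simp [downAt]⟩
    · exact ⟨((z + 1, y), 1), by simp [upAt], by simp [downAt]⟩
  obtain ⟨p, b1⟩ := δ
  obtain ⟨q, b2⟩ := ε
  cases b1 <;> cases b2
  · exfalso
    obtain ⟨a1, a2⟩ := a
    obtain ⟨b1, b2⟩ := b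
    obtain ⟨x, y⟩ := p
    obtain ⟨z, w⟩ := q
    simp [vertices_false] at ha hb hab hne
    omega
  · obtain ⟨e, h1, h2⟩ := key q p ha.2 ha.1 hb.2 hb.1
    exact ⟨e, .inr ⟨h1, h2⟩⟩
  · obtain ⟨e, h1, h2⟩ := key p q ha.1 ha.2 hb.1 hb.2
    exact ⟨e, .inl ⟨h1, h2⟩⟩
  · exfalso
    obtain ⟨a1, a2⟩ := a
    obtain ⟨b1, b2⟩ := b
    obtain ⟨x, y⟩ := p
    obtain ⟨z, w⟩ := q
    simp [vertices_true] at ha hb hab hne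
    omega

/-- Around a vertex, five of the six steps between consecutive sectors already link the ends of the
sixth; this supplies the face cycles of the dual graph. -/
theorem eqvGen_around {α : Type*} {r : α → α → Prop} (f : Fin 6 → α) (k : Fin 6)
    (h : ∀ i, i ≠ k → EqvGen r (f (i + 5)) (f i)) : EqvGen r (f k) (f (k + 5)) := by
  have e : ∀ k : Fin 6, (k + 1 ≠ k ∧ k + 2 ≠ k ∧ k + 3 ≠ k ∧ k + 4 ≠ k ∧ k + 5 ≠ k) ∧
      k + 1 + 5 = k ∧ k + 2 + 5 = k + 1 ∧ k + 3 + 5 = k + 2 ∧ k + 4 + 5 = k + 3 ∧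
      k + 5 + 5 = k + 4 := by decide
  obtain ⟨⟨n1, n2, n3, n4, n5⟩, e1, e2, e3, e4, e5⟩ := e k
  have a1 := h _ n1
  have a2 := h _ n2
  have a3 := h _ n3
  have a4 := h _ n4
  have a5 := h _ n5
  rw [e1] at a1
  rw [e2] at a2
  rw [e3] at a3
  rw [e4] at a4
  rw [e5] at a5
  exact (((a1.trans _ _ _ a2).trans _ _ _ a3).trans _ _ _ a4).trans _ _ _ a5

/-- The segment from `v` to `v + unitVec i`. -/
def spoke (v : ℤ × ℤ) : Fin 6 → (ℤ × ℤ) × Fin 3 :=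
  ![(v, 0), (v, 1), (v, 2), (v + (-1, 0), 0), (v + (0, -1), 1), (v + (1, -1), 2)]

theorem spoke_injective (v : ℤ × ℤ) : Function.Injective (spoke v) := by
  obtain ⟨x, y⟩ := v
  intro i j
  fin_cases i <;> fin_cases j <;> simp [spoke]

theorem upAt_downAt_spoke (v : ℤ × ℤ) (i : Fin 6) :
    (upAt (spoke v i) = sector v i ∧ downAt (spoke v i) = sector v (i + 5)) ∨
      (upAt (spoke v i) = sector v (i + 5) ∧ downAt (spoke v i) = sector v i) := by
  obtain ⟨x, y⟩ := v
  fin_cases i <;> simp [spoke, sector, upAt, downAt, Prod.ext_iff]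

theorem ends_spoke (v : ℤ × ℤ) (i : Fin 6) :
    ((spoke v i).1 = v ∧ tip (spoke v i) = v + unitVec i) ∨
      ((spoke v i).1 = v + unitVec i ∧ tip (spoke v i) = v) := by
  obtain ⟨x, y⟩ := v
  fin_cases i <;> simp [spoke, tip, step, unitVec]

theorem exists_spoke {v : ℤ × ℤ} {e : (ℤ × ℤ) × Fin 3} (h : e.1 = v ∨ tip e = v) :
    ∃ i, e = spoke v i := by
  obtain ⟨⟨x, y⟩, d⟩ := e
  rcases h with rfl | rfl
  · fin_cases d
    exacts [⟨0, rfl⟩, ⟨1, rfl⟩, ⟨2, rfl⟩]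
  · fin_cases d
    exacts [⟨3, by simp [spoke, tip, step]⟩, ⟨4, by simp [spoke, tip, step]⟩,
      ⟨5, by simp [spoke, tip, step]⟩]

theorem spoke_mem_edges {C : Finset Triangle} {v : ℤ × ℤ} {i : Fin 6} :
    spoke v i ∈ edges C ↔ sector v i ∈ C ∨ sector v (i + 5) ∈ C := by
  rw [mem_edges]
  rcases upAt_downAt_spoke v i with ⟨h1, h2⟩ | ⟨h1, h2⟩ <;> rw [h1, h2]
  exact or_comm

/-- The unit triangles of a rhombus with side length `2 * N`. -/
noncomputable def boxTriangles (N : ℕ) : Finset Triangle :=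
  (Finset.Ico (-N : ℤ) N ×ˢ Finset.Ico (-N : ℤ) N) ×ˢ Finset.univ

/-- The vertices of a rhombus with side length `2 * N`. -/
noncomputable def boxVerts (N : ℕ) : Finset (ℤ × ℤ) := Finset.Icc (-N : ℤ) N ×ˢ Finset.Icc (-N : ℤ) N

/-- Direct count: `12N² + 4N` segments at most, `(2N + 1)²` vertices and `8N²` triangles. -/
theorem card_edges_boxTriangles (N : ℕ) :
    (edges (boxTriangles N)).card + 1 ≤ (boxVerts N).card + (boxTriangles N).card := by
  have h : edges (boxTriangles N) ⊆
      ((Finset.Ico (-N : ℤ) N ×ˢ Finset.Icc (-N : ℤ) N) ×ˢ {0}) ∪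
      (((Finset.Icc (-N : ℤ) N ×ˢ Finset.Ico (-N : ℤ) N) ×ˢ {1}) ∪
        ((Finset.Ioc (-N : ℤ) N ×ˢ Finset.Ico (-N : ℤ) N) ×ˢ {2})) := by
    rintro ⟨⟨x, y⟩, d⟩ he
    rw [mem_edges] at he
    fin_cases d <;> simp [boxTriangles, upAt, downAt] at he ⊢ <;> omega
  have h1 := Finset.card_le_card h
  have h2 := h1.trans ((Finset.card_union_le _ _).trans
    (Nat.add_le_add_left (Finset.card_union_le _ _) _))
  have e1 : ((N : ℤ) + N).toNat = 2 * N := by omega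
  have e2 : ((N : ℤ) + 1 + N).toNat = 2 * N + 1 := by omega
  simp only [Finset.card_product, Finset.card_singleton, Int.card_Ico, Int.card_Icc, Int.card_Ioc,
    sub_neg_eq_add, e1, e2] at h2
  generalize (edges (boxTriangles N)).card = m at h2 ⊢
  simp only [boxVerts, boxTriangles, Finset.card_product, Int.card_Ico, Int.card_Icc,
    sub_neg_eq_add, e1, e2, Finset.card_univ, Fintype.card_bool]
  nlinarith

theorem mem_edges_boxTriangles {N : ℕ} {e : (ℤ × ℤ) × Fin 3} (h1 : e.1 ∈ boxVerts N)
    (h2 : tip e ∈ boxVerts N) : e ∈ edges (boxTriangles N) := by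
  obtain ⟨⟨x, y⟩, d⟩ := e
  rw [mem_edges]
  fin_cases d <;> simp [boxTriangles, boxVerts, upAt, downAt, tip, step] at h1 h2 ⊢ <;> omega

theorem spoke_mem_edges_boxTriangles {N : ℕ} {v : ℤ × ℤ} {i : Fin 6} (h1 : v ∈ boxVerts N)
    (h2 : v + unitVec i ∈ boxVerts N) : spoke v i ∈ edges (boxTriangles N) := by
  rcases ends_spoke v i with ⟨h, h'⟩ | ⟨h, h'⟩
  · exact mem_edges_boxTriangles (by rwa [h]) (by rwa [h'])
  · exact mem_edges_boxTriangles (by rwa [h]) (by rwa [h'])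

theorem exists_subset_boxTriangles (C : Finset Triangle) :
    ∃ N : ℕ, C ⊆ boxTriangles N ∧ verts C ⊆ boxVerts N := by
  have H : ∃ N : ℕ, ∀ δ ∈ C, |δ.1.1| + |δ.1.2| ≤ N := by
    refine ⟨∑ δ ∈ C, (|δ.1.1| + |δ.1.2|).toNat, fun δ hδ => ?_⟩
    have : (|δ.1.1| + |δ.1.2|).toNat ≤ ∑ δ ∈ C, (|δ.1.1| + |δ.1.2|).toNat :=
      Finset.single_le_sum (f := fun δ : Triangle => (|δ.1.1| + |δ.1.2|).toNat)
        (fun _ _ => Nat.zero_le _) hδ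
    exact Int.toNat_le.1 this
  obtain ⟨N, hN⟩ := H
  have h2 : C ⊆ boxTriangles (N + 1) := by
    rintro ⟨⟨x, y⟩, b⟩ h
    have := hN _ h
    simp only at this
    have := neg_abs_le x
    have := le_abs_self x
    have := neg_abs_le y
    have := le_abs_self y
    have := abs_nonneg x
    have := abs_nonneg y
    simp [boxTriangles]
    omega
  refine ⟨N + 1, h2, ?_⟩
  rintro ⟨a, c⟩ hv
  simp only [verts, Finset.mem_biUnion] at hv
  obtain ⟨⟨⟨x, y⟩, b⟩, hδ, hv⟩ := hv
  have := h2 hδ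
  cases b <;> simp [boxTriangles, boxVerts, vertices_true, vertices_false] at this hv ⊢ <;> omega

/-- The Euler characteristic of a non-empty region with connected complement is at least one. -/
theorem card_edges_lt (C : Finset Triangle) (hne : C.Nonempty)
    (hC : (triangleGraph.induce {δ | δ ∉ C}).Preconnected) :
    (edges C).card + 1 ≤ (verts C).card + C.card := by
  classical
  obtain ⟨N, hN, hNv⟩ := exists_subset_boxTriangles C
  -- All triangles outside the box are collapsed to the single node `none`.
  let π : Triangle → Option Triangle := fun δ => if δ ∈ boxTriangles N then some δ else none
  let bd : ℤ × ℤ → Finset ((ℤ × ℤ) × Fin 3) := fun v =>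
    (edges (boxTriangles N)).filter fun e => e.1 = v ∨ tip e = v
  have hedges : ∀ {e}, e ∉ edges (boxTriangles N) → π (upAt e) = none ∧ π (downAt e) = none := by
    intro e he
    rw [mem_edges] at he
    push Not at he
    simp [π, he]
  have hends : ∀ {e}, e ∈ edges C → e.1 ∈ verts C ∧ tip e ∈ verts C := by
    intro e he
    obtain ⟨δ, hδ, he⟩ := Finset.mem_biUnion.1 he
    have := ends_mem_vertices he
    exact ⟨Finset.mem_biUnion.2 ⟨δ, hδ, this.1⟩, Finset.mem_biUnion.2 ⟨δ, hδ, this.2⟩⟩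
  -- In the dual graph the nodes are the uncovered triangles of the box and its outside, the edges
  -- cross the segments of the box that are not in `C`, and the faces are the vertices of the box
  -- off `C`. Subtracting the result from the count for the whole box gives the claim.
  have key := card_add_card_faces_le (fun e => π (upAt e)) (fun e => π (downAt e)) bd
    (Finset.insertNone (boxTriangles N \ C)) _ (boxVerts N \ verts C)
    (edges (boxTriangles N) \ edges C) rfl ?_ ?_ ?_ ?_
  · rw [Finset.card_insertNone, Finset.card_sdiff_of_subset hN, Finset.card_sdiff_of_subset hNv,
      Finset.card_sdiff_of_subset (show edges C ⊆ edges (boxTriangles N) from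
        Finset.biUnion_subset_biUnion_of_subset_left _ hN)] at key
    have h1 := card_edges_boxTriangles N
    have h2 := Finset.card_le_card hN
    have h3 := Finset.card_le_card hNv
    have h4 : (edges C).card ≤ (edges (boxTriangles N)).card :=
      Finset.card_le_card (Finset.biUnion_subset_biUnion_of_subset_left _ hN)
    omega
  · intro v hv e he
    simp only [bd, Finset.mem_filter, Finset.mem_sdiff] at he hv ⊢
    refine ⟨he.1, fun heC => ?_⟩
    have := hends heC
    rcases he.2 with rfl | rfl
    exacts [hv.2 this.1, hv.2 this.2]
  · intro v _ e he
    obtain ⟨k, rfl⟩ := exists_spoke (Finset.mem_filter.1 he).2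
    have stp : ∀ i, i ≠ k → EqvGen (Joined (fun e => π (upAt e)) (fun e => π (downAt e))
        ((bd v).erase (spoke v k))) (π (sector v (i + 5))) (π (sector v i)) := by
      intro i hi
      -- A spoke that is not an edge of the box has `none` on both sides, so its step is trivial.
      by_cases hb : spoke v i ∈ edges (boxTriangles N)
      · have : EqvGen (Joined (fun e => π (upAt e)) (fun e => π (downAt e))
            ((bd v).erase (spoke v k))) (π (upAt (spoke v i))) (π (downAt (spoke v i))) := by
          refine EqvGen.rel _ _ ⟨spoke v i, ?_, rfl, rfl⟩
          refine Finset.mem_erase.2 ⟨(spoke_injective v).ne hi, Finset.mem_filter.2 ⟨hb, ?_⟩⟩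
          rcases ends_spoke v i with ⟨h, -⟩ | ⟨-, h⟩
          exacts [.inl h, .inr h]
        rcases upAt_downAt_spoke v i with ⟨h1, h2⟩ | ⟨h1, h2⟩ <;> rw [h1, h2] at this
        exacts [this.symm, this]
      · have := hedges hb
        rcases upAt_downAt_spoke v i with ⟨h1, h2⟩ | ⟨h1, h2⟩ <;> rw [h1, h2] at this <;>
          rw [this.1, this.2] <;> exact EqvGen.refl _
    have chain : EqvGen (Joined (fun e => π (upAt e)) (fun e => π (downAt e))
        ((bd v).erase (spoke v k))) (π (sector v k)) (π (sector v (k + 5))) :=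
       eqvGen_around (fun i => π (sector v i)) k stp
    rcases upAt_downAt_spoke v k with ⟨h1, h2⟩ | ⟨h1, h2⟩ <;> simp only [h1, h2]
    exacts [chain, chain.symm]
  · intro S hS hSne
    obtain ⟨δ, hδ⟩ := hne
    obtain ⟨v0, hv0⟩ : ∃ v, v ∈ verts C := by
      obtain ⟨p, hp⟩ : δ.vertices.Nonempty := by
        obtain ⟨p, b⟩ := δ
        cases b
        exacts [⟨_, by rw [vertices_false]; exact Finset.mem_insert_self _ _⟩,
          ⟨_, by rw [vertices_true]; exact Finset.mem_insert_self _ _⟩]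
      exact ⟨p, Finset.mem_biUnion.2 ⟨δ, hδ, hp⟩⟩
    -- The vertex of `S` nearest to a vertex `v0` of `C` has a neighbour in the box one step closer
    -- to `v0`, hence outside `S`. The segment between the two is free.
    obtain ⟨v, hv, hmin⟩ := Finset.exists_min_image S
      (fun v => |v.1 - v0.1| + |v.2 - v0.2|) hSne
    have hvS := Finset.mem_sdiff.1 (hS hv)
    have hv0b := hNv hv0
    have hmove : ∃ i, v + unitVec i ∈ boxVerts N ∧ v + unitVec i ∉ S := by
      have hne : v.1 ≠ v0.1 ∨ v.2 ≠ v0.2 := by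
        by_contra h
        push Not at h
        exact hvS.2 (Prod.ext h.1 h.2 ▸ hv0)
      have hvb := hvS.1
      obtain ⟨x, y⟩ := v
      obtain ⟨a, b⟩ := v0
      simp only [boxVerts, Finset.mem_product, Finset.mem_Icc] at hvb hv0b hne
      have hcase : x < a ∨ a < x ∨ y < b ∨ b < y := by omega
      rcases hcase with h | h | h | h
      · refine ⟨0, by simp [boxVerts, unitVec]; omega, fun hm => ?_⟩
        have := hmin _ hm
        simp [unitVec] at this
        rw [abs_of_nonpos (by omega), abs_of_nonpos (by omega)] at this
        omega
      · refine ⟨3, by simp [boxVerts, unitVec]; omega, fun hm => ?_⟩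
        have := hmin _ hm
        simp [unitVec] at this
        rw [abs_of_nonneg (by omega), abs_of_nonneg (by omega)] at this
        omega
      · refine ⟨1, by simp [boxVerts, unitVec]; omega, fun hm => ?_⟩
        have := hmin _ hm
        simp [unitVec] at this
        rw [abs_of_nonpos (by omega), abs_of_nonpos (by omega)] at this
        omega
      · refine ⟨4, by simp [boxVerts, unitVec]; omega, fun hm => ?_⟩
        have := hmin _ hm
        simp [unitVec] at this
        rw [abs_of_nonneg (by omega), abs_of_nonneg (by omega)] at this
        omega
    obtain ⟨i, hi, hiS⟩ := hmove
    refine ⟨v, hv, spoke v i, ?_, ?_⟩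
    · refine Finset.mem_filter.2 ⟨spoke_mem_edges_boxTriangles hvS.1 hi, ?_⟩
      rcases ends_spoke v i with ⟨h, -⟩ | ⟨-, h⟩
      exacts [.inl h, .inr h]
    · intro g hg hgv hmem
      have := (Finset.mem_filter.1 hmem).2
      rcases ends_spoke v i with ⟨h1, h2⟩ | ⟨h1, h2⟩ <;> rw [h1, h2] at this <;>
        rcases this with rfl | rfl <;> first | exact hgv rfl | exact hiS hg
  -- Every node is linked to `none` through an uncovered triangle `ε` beyond the box.
  · obtain ⟨ε, hε⟩ := Infinite.exists_notMem_finset (boxTriangles N ∪ C)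
    rw [Finset.mem_union, not_or] at hε
    have walk : ∀ x y : {δ | δ ∉ C}, (triangleGraph.induce {δ | δ ∉ C}).Reachable x y →
        EqvGen (Joined (fun e => π (upAt e)) (fun e => π (downAt e))
          (edges (boxTriangles N) \ edges C)) (π x.1) (π y.1) := by
      rintro x y ⟨w⟩
      induction w with
      | nil => exact EqvGen.refl _
      | @cons a b c h w ih =>
        refine EqvGen.trans _ _ _ ?_ ih
        obtain ⟨e, he⟩ := exists_common_edge (SimpleGraph.induce_adj.1 h)
        have ha : a.1 ∉ C := a.2
        have hb : b.1 ∉ C := b.2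
        have heC : e ∉ edges C := by
          rw [mem_edges]
          rcases he with ⟨h1, h2⟩ | ⟨h1, h2⟩ <;> rw [← h1, ← h2] <;> tauto
        by_cases heb : e ∈ edges (boxTriangles N)
        · have : EqvGen (Joined (fun e => π (upAt e)) (fun e => π (downAt e))
              (edges (boxTriangles N) \ edges C)) (π (upAt e)) (π (downAt e)) :=
            EqvGen.rel _ _ ⟨e, Finset.mem_sdiff.2 ⟨heb, heC⟩, rfl, rfl⟩
          rcases he with ⟨h1, h2⟩ | ⟨h1, h2⟩ <;> rw [← h1, ← h2] at this
          exacts [this, this.symm]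
        · have := hedges heb
          rcases he with ⟨h1, h2⟩ | ⟨h1, h2⟩ <;> rw [← h1, ← h2] at this <;>
            rw [this.1, this.2] <;> exact EqvGen.refl _
    have toNone : ∀ a ∈ Finset.insertNone (boxTriangles N \ C),
        EqvGen (Joined (fun e => π (upAt e)) (fun e => π (downAt e))
          (edges (boxTriangles N) \ edges C)) none a := by
      intro a ha
      cases a with
      | none => exact EqvGen.refl _
      | some a =>
        have ha : a ∈ boxTriangles N \ C := by simpa using ha
        rw [Finset.mem_sdiff] at ha
        have := walk ⟨ε, hε.2⟩ ⟨a, ha.2⟩ (hC _ _)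
        simpa only [π, hε.1, ha.1, if_true, if_false] using this
    exact fun a ha b hb => (toNone a ha).symm.trans _ _ _ (toNone b hb)

/-! ### Gaps around vertices and the turning of the boundary -/

/-- The number of pairs of a vertex of `C` and a direction with the property `p`. -/
def flagCount (C : Finset Triangle) (p : ℤ × ℤ → Fin 6 → Prop) [∀ v i, Decidable (p v i)] : ℕ :=
  ((verts C ×ˢ Finset.univ).filter fun f : (ℤ × ℤ) × Fin 6 => p f.1 f.2).card

theorem flagCount_eq_sum (C : Finset Triangle) (p : ℤ × ℤ → Fin 6 → Prop)
    [∀ v i, Decidable (p v i)] :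
    flagCount C p = ∑ v ∈ verts C, (Finset.univ.filter (p v)).card := by
  simp only [flagCount, Finset.card_filter, Finset.sum_product]

theorem card_vertices (δ : Triangle) : δ.vertices.card = 3 := by
  obtain ⟨⟨x, y⟩, b⟩ := δ
  cases b
  · rw [vertices_false, Finset.card_eq_three]
    exact ⟨_, _, _, by simp, by simp, by simp, rfl⟩
  · rw [vertices_true, Finset.card_eq_three]
    exact ⟨_, _, _, by simp, by simp, by simp, rfl⟩

theorem flagCount_covered (C : Finset Triangle) :
    flagCount C (fun v i => sector v i ∈ C) = 3 * C.card := by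
  have hmaps : ∀ f ∈ (verts C ×ˢ Finset.univ).filter
      (fun f : (ℤ × ℤ) × Fin 6 => sector f.1 f.2 ∈ C), sector f.1 f.2 ∈ C :=
    fun f hf => (Finset.mem_filter.1 hf).2
  rw [flagCount, Finset.card_eq_sum_card_fiberwise hmaps, mul_comm, ← smul_eq_mul, ← Finset.sum_const]
  refine Finset.sum_congr rfl fun δ hδ => ?_
  rw [← card_vertices δ]
  refine Finset.card_nbij Prod.fst ?_ ?_ ?_
  · rintro ⟨v, i⟩ h
    exact mem_vertices_iff.2 ⟨i, (Finset.mem_filter.1 h).2⟩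
  · rintro ⟨v, i⟩ h ⟨w, j⟩ h' hvw
    obtain rfl : v = w := hvw
    have h1 := (Finset.mem_filter.1 h).2
    have h2 := (Finset.mem_filter.1 h').2
    exact Prod.ext rfl (sector_injective v (h1.trans h2.symm))
  · intro v hv
    obtain ⟨i, hi⟩ := mem_vertices_iff.1 hv
    refine ⟨(v, i), ?_, rfl⟩
    simp only [Finset.coe_filter, Finset.mem_filter, Finset.mem_product, Set.mem_ofPred_eq]
    exact ⟨⟨⟨mem_verts.2 ⟨i, hi ▸ hδ⟩, Finset.mem_univ _⟩, hi ▸ hδ⟩, hi⟩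

theorem spoke_eq_of_end {e : (ℤ × ℤ) × Fin 3} {v : ℤ × ℤ} {i : Fin 6} (h : spoke v i = e) :
    v = e.1 ∨ v = tip e := by
  subst h
  rcases ends_spoke v i with ⟨h, -⟩ | ⟨-, h⟩
  exacts [.inl h.symm, .inr h.symm]

theorem flagCount_spoke (C : Finset Triangle) :
    flagCount C (fun v i => spoke v i ∈ edges C) = 2 * (edges C).card := by
  have hmaps : ∀ f ∈ (verts C ×ˢ Finset.univ).filter
      (fun f : (ℤ × ℤ) × Fin 6 => spoke f.1 f.2 ∈ edges C), spoke f.1 f.2 ∈ edges C :=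
    fun f hf => (Finset.mem_filter.1 hf).2
  rw [flagCount, Finset.card_eq_sum_card_fiberwise hmaps, mul_comm, ← smul_eq_mul, ← Finset.sum_const]
  refine Finset.sum_congr rfl fun e he => ?_
  have hne : e.1 ≠ tip e := by
    obtain ⟨⟨x, y⟩, d⟩ := e
    fin_cases d <;> simp [tip, step]
  rw [← Finset.card_pair hne]
  refine Finset.card_nbij Prod.fst ?_ ?_ ?_
  · rintro ⟨v, i⟩ h
    have := spoke_eq_of_end (Finset.mem_filter.1 h).2
    simpa using this
  · rintro ⟨v, i⟩ h ⟨w, j⟩ h' hvw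
    obtain rfl : v = w := hvw
    have h1 := (Finset.mem_filter.1 h).2
    have h2 := (Finset.mem_filter.1 h').2
    exact Prod.ext rfl (spoke_injective v (h1.trans h2.symm))
  · intro v hv
    have hv' : e.1 = v ∨ tip e = v := by
      simp only [Finset.coe_insert, Finset.coe_singleton, Set.mem_insert_iff,
        Set.mem_singleton_iff] at hv
      exact hv.imp Eq.symm Eq.symm
    obtain ⟨i, rfl⟩ := exists_spoke hv'
    refine ⟨(v, i), ?_, rfl⟩
    simp only [Finset.coe_filter, Finset.mem_filter, Finset.mem_product, Set.mem_ofPred_eq]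
    refine ⟨⟨⟨mem_verts.2 ?_, Finset.mem_univ _⟩, he⟩, trivial⟩
    rcases spoke_mem_edges.1 he with h | h
    exacts [⟨_, h⟩, ⟨_, h⟩]

set_option maxRecDepth 100000 in
theorem card_spokes_word : ∀ w : Fin 6 → Bool,
    (Finset.univ.filter fun i => w i = true ∨ w (i + 5) = true).card =
      (Finset.univ.filter fun i => w i = true).card +
        (Finset.univ.filter fun i => w i = true ∧ ¬ w (i + 5) = true).card := by
  decide

set_option maxRecDepth 100000 in
-- Each maximal gap of `g` uncovered sectors is registered at the covered sector which follows it
-- counterclockwise. The claim is the sum over the gaps of `2 + [g ≥ 3] + [g = 4] + 2 * [g = 5] = g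
-- + [g = 1]`, valid for `1 ≤ g ≤ 5`.
theorem card_gaps_word : ∀ w : Fin 6 → Bool, (∃ i, w i = true) →
    2 * (Finset.univ.filter fun i => w i = true ∧ ¬ w (i + 5) = true).card +
      (Finset.univ.filter fun i => w i = true ∧ ¬ w (i + 5) = true ∧ ¬ w (i + 4) = true ∧
        ¬ w (i + 3) = true).card +
      (Finset.univ.filter fun i => w i = true ∧ ¬ w (i + 5) = true ∧ ¬ w (i + 4) = true ∧
        ¬ w (i + 3) = true ∧ ¬ w (i + 2) = true ∧ w (i + 1) = true).card +
      2 * (Finset.univ.filter fun i => w i = true ∧ ¬ w (i + 5) = true ∧ ¬ w (i + 4) = true ∧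
        ¬ w (i + 3) = true ∧ ¬ w (i + 2) = true ∧ ¬ w (i + 1) = true).card ≤
    (Finset.univ.filter fun i => ¬ w i = true).card +
      (Finset.univ.filter fun i => w i = true ∧ ¬ w (i + 5) = true ∧ w (i + 4) = true).card := by
  decide

set_option maxRecDepth 100000 in
/-- Here `0`, `1` and `2` stand for covered sectors, for uncovered sectors whose outer triangle is
covered, and for the others. -/
theorem card_turns_word : ∀ s0 s1 s2 s3 s4 s5 : Fin 3, ∀ s : Fin 6 → Fin 3,
    s = ![s0, s1, s2, s3, s4, s5] →
    (∀ i, s i = 0 → s (i + 1) = 1 → s (i + 2) ≠ 0 ∧ (s (i + 2) = 1 → s (i + 3) ≠ 0 ∧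
      (s (i + 3) = 1 → s (i + 4) ≠ 0 ∧ (s (i + 4) = 1 → s (i + 5) ≠ 0 ∧ s (i + 5) ≠ 1)))) →
    (Finset.univ.filter fun i => s (i + 5) = 0 ∧ s i = 1).card ≤
      (Finset.univ.filter fun i => s i = 1 ∧ s (i + 1) = 2 ∧ s (i + 5) ≠ 2).card := by
  intro s0 s1 s2 s3 s4 s5 s hs
  subst hs
  revert s0 s1 s2 s3 s4 s5
  decide

/-- The flags on the right number the boundary segments: each of them has the region on its left
when seen from exactly one of its two ends. They also number the gaps, one for each. -/
theorem two_mul_card_edges (C : Finset Triangle) :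
    2 * (edges C).card = 3 * C.card +
      flagCount C (fun v i => sector v i ∈ C ∧ sector v (i + 5) ∉ C) := by
  rw [← flagCount_spoke, ← flagCount_covered, flagCount_eq_sum, flagCount_eq_sum,
    flagCount_eq_sum, ← Finset.sum_add_distrib]
  refine Finset.sum_congr rfl fun v _ => ?_
  simpa [spoke_mem_edges] using card_spokes_word fun i => decide (sector v i ∈ C)

theorem flagCount_uncovered (C : Finset Triangle) :
    flagCount C (fun v i => sector v i ∉ C) + 3 * C.card = 6 * (verts C).card := by
  rw [← flagCount_covered, flagCount_eq_sum, flagCount_eq_sum, ← Finset.sum_add_distrib, mul_comm,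
    ← smul_eq_mul, ← Finset.sum_const]
  refine Finset.sum_congr rfl fun v _ => ?_
  rw [add_comm, Finset.card_filter_add_card_filter_not]
  rfl

theorem flagCount_gaps (C : Finset Triangle) :
    2 * flagCount C (fun v i => sector v i ∈ C ∧ sector v (i + 5) ∉ C) +
      flagCount C (fun v i => sector v i ∈ C ∧ sector v (i + 5) ∉ C ∧ sector v (i + 4) ∉ C ∧
        sector v (i + 3) ∉ C) +
      flagCount C (fun v i => sector v i ∈ C ∧ sector v (i + 5) ∉ C ∧ sector v (i + 4) ∉ C ∧
        sector v (i + 3) ∉ C ∧ sector v (i + 2) ∉ C ∧ sector v (i + 1) ∈ C) +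
      2 * flagCount C (fun v i => sector v i ∈ C ∧ sector v (i + 5) ∉ C ∧ sector v (i + 4) ∉ C ∧
        sector v (i + 3) ∉ C ∧ sector v (i + 2) ∉ C ∧ sector v (i + 1) ∉ C) ≤
    flagCount C (fun v i => sector v i ∉ C) +
      flagCount C (fun v i => sector v i ∈ C ∧ sector v (i + 5) ∉ C ∧ sector v (i + 4) ∈ C) := by
  simp only [flagCount_eq_sum, Finset.mul_sum, ← Finset.sum_add_distrib]
  refine Finset.sum_le_sum fun v hv => ?_
  simpa using card_gaps_word (fun i => decide (sector v i ∈ C)) (by simpa using mem_verts.1 hv)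

theorem adj_sector {v : ℤ × ℤ} {i : Fin 6} {ε : Triangle}
    (h : triangleGraph.Adj (sector v i) ε) :
    ε = sector v (i + 1) ∨ ε = sector v (i + 5) ∨ ε = outer v i := by
  obtain ⟨e, he⟩ := exists_common_edge h
  have hmem : e ∈ (sector v i).edges := by
    rw [mem_edges_iff]
    rcases he with ⟨h, -⟩ | ⟨-, h⟩
    exacts [.inl h, .inr h]
  clear h
  obtain ⟨x, y⟩ := v
  fin_cases i <;>
    simp [sector, edges_true, edges_false] at hmem <;>
    rcases hmem with rfl | rfl | rfl <;>
    simp [sector, outer, unitVec, upAt, downAt, Prod.ext_iff] at he ⊢ <;> grind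

/-- No bounded set of uncovered triangles is closed under uncovered adjacent triangles. -/
theorem not_closed_sectors {C : Finset Triangle}
    (hC : (triangleGraph.induce {δ | δ ∉ C}).Preconnected) (v : ℤ × ℤ) (J : Finset (Fin 6))
    (hJ : J.Nonempty) (h : ∀ i ∈ J, sector v i ∉ C ∧ outer v i ∈ C ∧
      (sector v (i + 1) ∈ C ∨ i + 1 ∈ J) ∧ (sector v (i + 5) ∈ C ∨ i + 5 ∈ J)) : False := by
  obtain ⟨j, hj⟩ := hJ
  obtain ⟨ε, hε⟩ := Infinite.exists_notMem_finset (C ∪ J.image (sector v))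
  rw [Finset.mem_union, not_or] at hε
  have walk : ∀ x y : {δ | δ ∉ C}, (triangleGraph.induce {δ | δ ∉ C}).Reachable x y →
      x.1 ∈ J.image (sector v) → y.1 ∈ J.image (sector v) := by
    rintro x y ⟨w⟩
    induction w with
    | nil => exact id
    | @cons a b c hab w ih =>
      intro ha
      refine ih ?_
      obtain ⟨i, hi, hia⟩ := Finset.mem_image.1 ha
      have hb : b.1 ∉ C := b.2
      have hadj := SimpleGraph.induce_adj.1 hab
      rw [← hia] at hadj
      obtain ⟨-, h1, h2, h3⟩ := h i hi
      rcases adj_sector hadj with hb' | hb' | hb' <;> rw [hb'] at hb ⊢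
      · exact Finset.mem_image_of_mem _ (h2.resolve_left hb)
      · exact Finset.mem_image_of_mem _ (h3.resolve_left hb)
      · exact absurd h1 hb
  exact hε.2 (walk ⟨sector v j, (h j hj).1⟩ ⟨ε, hε.1⟩ (hC _ _) (Finset.mem_image_of_mem _ hj))

/-- Label a sector `0` if it is covered, `1` if it is uncovered with covered outer triangle, and `2`
otherwise. A block of labels `1` that follows a `0` must end at a `2`: if it ended at a `0`, its
sectors would form a hole. The last `1` of the block is the flag counted on the right. It is never
preceded by a `2`, and this extra condition later leaves room for the teeth. -/
theorem card_turns_le {C : Finset Triangle}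
    (hC : (triangleGraph.induce {δ | δ ∉ C}).Preconnected) (v : ℤ × ℤ) :
    (Finset.univ.filter fun i => sector v (i + 5) ∈ C ∧ sector v i ∉ C ∧ outer v i ∈ C).card ≤
      (Finset.univ.filter fun i => (sector v i ∉ C ∧ outer v i ∈ C) ∧
        (sector v (i + 1) ∉ C ∧ outer v (i + 1) ∉ C) ∧
        ¬ (sector v (i + 5) ∉ C ∧ outer v (i + 5) ∉ C)).card := by
  let s : Fin 6 → Fin 3 := fun i =>
    if sector v i ∈ C then 0 else if outer v i ∈ C then 1 else 2
  have s0 : ∀ i, s i = 0 ↔ sector v i ∈ C := by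
    intro i; simp only [s]; split_ifs <;> simp_all
  have s1 : ∀ i, s i = 1 ↔ sector v i ∉ C ∧ outer v i ∈ C := by
    intro i; simp only [s]; split_ifs <;> simp_all
  have s2 : ∀ i, s i = 2 ↔ sector v i ∉ C ∧ outer v i ∉ C := by
    intro i; simp only [s]; split_ifs <;> simp_all
  have key := card_turns_word (s 0) (s 1) (s 2) (s 3) (s 4) (s 5) s
    (by funext i; fin_cases i <;> rfl) ?_
  · simpa only [ne_eq, s0, s1, s2] using key
  · have e : ∀ i : Fin 6, i + 1 + 1 = i + 2 ∧ i + 2 + 1 = i + 3 ∧ i + 3 + 1 = i + 4 ∧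
        i + 4 + 1 = i + 5 ∧ i + 5 + 1 = i ∧ i + 1 + 5 = i ∧ i + 2 + 5 = i + 1 ∧
        i + 3 + 5 = i + 2 ∧ i + 4 + 5 = i + 3 ∧ i + 5 + 5 = i + 4 := by decide
    intro i h0 h1
    obtain ⟨e1, e2, e3, e4, e5, f1, f2, f3, f4, f5⟩ := e i
    rw [s0] at h0
    -- In each case one to five sectors after `i` have label `1` and the next one is covered, so
    -- they are closed under uncovered adjacent triangles.
    refine ⟨fun h2 => ?_, fun h2 => ⟨fun h3 => ?_, fun h3 => ⟨fun h4 => ?_, fun h4 =>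
      ⟨fun h5 => ?_, fun h5 => ?_⟩⟩⟩⟩ <;> simp only [s0, s1] at *
    · refine not_closed_sectors hC v {i + 1} (by simp) ?_
      simp [*]
    · refine not_closed_sectors hC v {i + 1, i + 2} (by simp) ?_
      simp [*]
    · refine not_closed_sectors hC v {i + 1, i + 2, i + 3} (by simp) ?_
      simp [*]
    · refine not_closed_sectors hC v {i + 1, i + 2, i + 3, i + 4} (by simp) ?_
      simp [*]
    · refine not_closed_sectors hC v {i + 1, i + 2, i + 3, i + 4, i + 5} (by simp) ?_
      simp [*]

theorem flagCount_mono_of_injOn {C : Finset Triangle} {p q : ℤ × ℤ → Fin 6 → Prop}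
    [∀ v i, Decidable (p v i)] [∀ v i, Decidable (q v i)]
    (φ : (ℤ × ℤ) × Fin 6 → (ℤ × ℤ) × Fin 6) (hφ : Function.Injective φ)
    (h : ∀ v ∈ verts C, ∀ i, p v i → (φ (v, i)).1 ∈ verts C ∧ q (φ (v, i)).1 (φ (v, i)).2) :
    flagCount C p ≤ flagCount C q := by
  refine Finset.card_le_card_of_injOn φ ?_ hφ.injOn
  rintro ⟨v, i⟩ hf
  have hf' := Finset.mem_filter.1 hf
  have := h v (Finset.mem_product.1 hf'.1).1 i hf'.2
  exact Finset.mem_filter.2 ⟨Finset.mem_product.2 ⟨this.1, Finset.mem_univ _⟩, this.2⟩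

/-- Each notch of angle `60°` begins a gap at its third corner. -/
theorem flagCount_notch_le (C : Finset Triangle) :
    flagCount C (fun v i => sector v i ∈ C ∧ sector v (i + 5) ∉ C ∧ sector v (i + 4) ∈ C) ≤
      flagCount C (fun v i => sector v (i + 5) ∈ C ∧ sector v i ∉ C ∧ outer v i ∈ C) := by
  refine flagCount_mono_of_injOn (fun f => (f.1 + unitVec f.2, f.2 + 3)) ?_ ?_
  · rintro ⟨v, i⟩ ⟨w, j⟩ h
    simp only [Prod.mk.injEq, add_left_inj] at h
    obtain ⟨h1, rfl⟩ := h
    simpa using h1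
  · intro v _ i ⟨h1, h2, h3⟩
    have e : i + 5 + 1 = i ∧ i + 5 + 4 = i + 3 ∧ i + 3 + 5 = i + 2 ∧ i + 3 + 1 = i + 4 := by
      clear h1 h2 h3; revert i; decide
    obtain ⟨e1, e2, e3, e4⟩ := e
    have t1 := sector_turn v i
    have t2 := sector_turn' v (i + 5)
    rw [e1, e2] at t2
    have t3 : outer (v + unitVec i) (i + 3) = sector v (i + 4) := by
      rw [outer, unitVec_add_three, add_neg_cancel_right, e4]
    simp only [e3]
    exact ⟨mem_verts.2 ⟨_, t1 ▸ h1⟩, t1 ▸ h1, t2 ▸ h2, t3 ▸ h3⟩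

theorem flagCount_turns_le {C : Finset Triangle}
    (hC : (triangleGraph.induce {δ | δ ∉ C}).Preconnected) :
    flagCount C (fun v i => sector v (i + 5) ∈ C ∧ sector v i ∉ C ∧ outer v i ∈ C) ≤
      flagCount C (fun v i => (sector v i ∉ C ∧ outer v i ∈ C) ∧
        (sector v (i + 1) ∉ C ∧ outer v (i + 1) ∉ C) ∧
        ¬ (sector v (i + 5) ∉ C ∧ outer v (i + 5) ∉ C)) := by
  rw [flagCount_eq_sum, flagCount_eq_sum]
  exact Finset.sum_le_sum fun v _ => card_turns_le hC v

/-! ### Teeth and the turning inequality -/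

/-- A protruding tile seen from its acute outer corner `A`, in the sector `j`, and its obtuse outer
corner `B`; these corners belong to no other tile. -/
def IsTooth (C : Finset Triangle) (A B : ℤ × ℤ) (j : Fin 6) : Prop :=
  (∀ i, sector A i ∈ C ↔ i = j) ∧
    ((B = A + unitVec j ∧ ∀ i, sector B i ∈ C ↔ i = j + 1 ∨ i = j + 2) ∨
      (B = A + unitVec (j + 1) ∧ ∀ i, sector B i ∈ C ↔ i = j + 4 ∨ i = j + 5))

/-- The first covered sector at the obtuse outer corner of a tooth. -/
theorem IsTooth.exists_obtuse {C : Finset Triangle} {A B : ℤ × ℤ} {j : Fin 6}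
    (h : IsTooth C A B j) : ∃ k, sector B k ∈ C ∧ sector B (k + 5) ∉ C ∧ sector B (k + 4) ∉ C ∧
      sector B (k + 3) ∉ C ∧ sector B (k + 2) ∉ C ∧ sector B (k + 1) ∈ C := by
  obtain ⟨-, ⟨-, h⟩ | ⟨-, h⟩⟩ := h
  · refine ⟨j + 1, ?_⟩
    simp only [h]
    clear h
    revert j; decide
  · refine ⟨j + 4, ?_⟩
    simp only [h]
    clear h
    revert j; decide

/-- The wide gap at the second outer corner of a tooth is preceded by another wide gap. -/
theorem IsTooth.exists_second {C : Finset Triangle} {A B : ℤ × ℤ} {j : Fin 6}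
    (h : IsTooth C A B j) : ∃ w k, (w = A ∨ w = B) ∧ sector w k ∈ C ∧ sector w (k + 5) ∉ C ∧
      sector w (k + 4) ∉ C ∧ sector w (k + 3) ∉ C ∧
      ∀ x l, x + unitVec (l + 1) = w → l + 5 = k → sector x (l + 5) ∉ C ∧ outer x (l + 5) ∉ C := by
  have e : ∀ j l : Fin 6, l + 5 = j → l = j + 1 := by decide
  obtain ⟨hA, ⟨rfl, hB⟩ | ⟨rfl, hB⟩⟩ := h
  · refine ⟨A, j, .inl rfl, (hA _).2 rfl, ?_, ?_, ?_, ?_⟩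
    · rw [hA]; clear hA hB; revert j; decide
    · rw [hA]; clear hA hB; revert j; decide
    · rw [hA]; clear hA hB; revert j; decide
    -- Both triangles in question lie in uncovered sectors at the other outer corner of the tooth.
    · intro x l hx hl
      obtain rfl := e _ _ hl
      have e1 : j + 1 + 5 = j ∧ j + 1 + 1 = j + 2 := by clear hA hB hl hx; revert j; decide
      have hx' : x + unitVec (j + 1) = A + unitVec j := by
        rw [← hx, e1.2, ← unitVec_add_two j]; abel
      rw [e1.1, outer_eq, ← sector_turn', hx', hB, hB]
      clear hA hB hl hx hx' e1; revert j; decide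
  · refine ⟨A + unitVec (j + 1), j + 4, .inr rfl, (hB _).2 (.inl rfl), ?_, ?_, ?_, ?_⟩
    · rw [hB]; clear hA hB; revert j; decide
    · rw [hB]; clear hA hB; revert j; decide
    · rw [hB]; clear hA hB; revert j; decide
    · intro x l hx hl
      obtain rfl := e _ _ hl
      have e1 : j + 4 + 1 + 5 = j + 4 ∧ j + 4 + 1 = j + 5 ∧ j + 4 + 1 + 1 = j ∧ j + 5 = j + 2 + 3 ∧
        j + 4 + 5 = j + 3 ∧ j + 4 + 4 = j + 2 := by
        clear hA hB hl hx; revert j; decide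
      rw [e1.2.2.1] at hx
      have hx' : x + unitVec (j + 5) = A := by
        rw [e1.2.2.2.1, unitVec_add_three]
        have := unitVec_add_two j
        rw [← this] at hx
        have : x = A + unitVec (j + 2) := by
          apply add_right_cancel (b := unitVec j)
          rw [hx]; abel
        rw [this]; abel
      rw [e1.1, outer_eq, ← sector_turn', e1.2.1, hx', hA, hA]
      clear hA hB hl hx hx' e1; revert j; decide

/-- The turning number bounds the number of teeth by the length of the boundary. -/
theorem four_mul_card_teeth_le {C : Finset Triangle}
    (hC : (triangleGraph.induce {δ | δ ∉ C}).Preconnected)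
    (hχ : (verts C).card + C.card ≤ (edges C).card + 1) {ι : Type*} [Fintype ι]
    (A B : ι → ℤ × ℤ) (j : ι → Fin 6) (h : ∀ t, IsTooth C (A t) (B t) (j t))
    (hA : Function.Injective A) (hB : Function.Injective B) :
    4 * Fintype.card ι ≤
      flagCount C (fun v i => sector v i ∈ C ∧ sector v (i + 5) ∉ C) + 6 := by
  have h1 := two_mul_card_edges C
  have h2 := flagCount_uncovered C
  have h3 := flagCount_gaps C
  have h4 := (flagCount_notch_le C).trans (flagCount_turns_le hC)
  have hAB : ∀ s t, A s ≠ B t := by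
    intro s t hst
    obtain ⟨k, hk, -, -, -, -, hk'⟩ := (h t).exists_obtuse
    rw [← hst, (h s).1] at hk hk'
    have e : ∀ k : Fin 6, k + 1 ≠ k := by decide
    exact e k (hk'.trans hk.symm)
  have h5 : Fintype.card ι ≤ flagCount C (fun v i => sector v i ∈ C ∧ sector v (i + 5) ∉ C ∧
      sector v (i + 4) ∉ C ∧ sector v (i + 3) ∉ C ∧ sector v (i + 2) ∉ C ∧
      sector v (i + 1) ∉ C) := by
    rw [← Finset.card_univ]
    refine Finset.card_le_card_of_injOn (fun t => (A t, j t)) ?_ ?_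
    · intro t _
      have hmem : sector (A t) (j t) ∈ C := ((h t).1 _).2 rfl
      refine Finset.mem_filter.2 ⟨Finset.mem_product.2 ⟨mem_verts.2 ⟨_, hmem⟩, Finset.mem_univ _⟩,
        hmem, ?_⟩
      simp only [(h t).1]
      generalize j t = k
      revert k; decide
    · intro s _ t _ hst
      exact hA (Prod.ext_iff.1 hst).1
  have h6 : Fintype.card ι ≤ flagCount C (fun v i => sector v i ∈ C ∧ sector v (i + 5) ∉ C ∧
      sector v (i + 4) ∉ C ∧ sector v (i + 3) ∉ C ∧ sector v (i + 2) ∉ C ∧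
      sector v (i + 1) ∈ C) := by
    choose k hk using fun t => (h t).exists_obtuse
    rw [← Finset.card_univ]
    refine Finset.card_le_card_of_injOn (fun t => (B t, k t)) ?_ ?_
    · intro t _
      exact Finset.mem_filter.2 ⟨Finset.mem_product.2 ⟨mem_verts.2 ⟨_, (hk t).1⟩,
        Finset.mem_univ _⟩, hk t⟩
    · intro s _ t _ hst
      exact hB (Prod.ext_iff.1 hst).1
  -- A flag `(x, l)` of the first kind gives three uncovered sectors in a row at `x + unitVec (l +
  -- 1)`, just before a covered one. The wide gap at the second outer corner of a tooth does not
  -- arise in this way: there the sector `l + 5` at `x` and its outer triangle are both uncovered.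
  have h7 : flagCount C (fun v i => (sector v i ∉ C ∧ outer v i ∈ C) ∧
        (sector v (i + 1) ∉ C ∧ outer v (i + 1) ∉ C) ∧
        ¬ (sector v (i + 5) ∉ C ∧ outer v (i + 5) ∉ C)) + Fintype.card ι ≤
      flagCount C (fun v i => sector v i ∈ C ∧ sector v (i + 5) ∉ C ∧ sector v (i + 4) ∉ C ∧
        sector v (i + 3) ∉ C) := by
    choose w k hw hk1 hk2 hk3 hk4 hk5 using fun t => (h t).exists_second
    rw [← Finset.card_univ, flagCount, flagCount, ← Finset.card_disjSum]
    refine Finset.card_le_card_of_injOn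
      (Sum.elim (fun f => (f.1 + unitVec (f.2 + 1), f.2 + 5)) (fun t => (w t, k t))) ?_ ?_
    · rintro (⟨x, l⟩ | t) hf
      · have hf' := (Finset.mem_filter.1 (Finset.inl_mem_disjSum.1 hf)).2
        obtain ⟨⟨g1, g2⟩, ⟨g3, g4⟩, -⟩ := hf'
        have e : l + 5 + 5 = l + 4 ∧ l + 5 + 4 = l + 1 + 2 ∧ l + 5 + 3 = l + 1 + 1 := by
          clear hf g1 g2 g3 g4; revert l; decide
        simp only at g1 g2 g3 g4
        rw [outer_eq] at g2
        rw [← sector_turn'] at g1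
        rw [← sector_turn] at g3
        rw [outer] at g4
        simp only [Sum.elim_inl]
        refine Finset.mem_filter.2 ⟨Finset.mem_product.2 ⟨mem_verts.2 ⟨_, g2⟩,
          Finset.mem_univ _⟩, ?_⟩
        simp only [e]
        exact ⟨g2, g1, g3, g4⟩
      · exact Finset.mem_filter.2 ⟨Finset.mem_product.2 ⟨mem_verts.2 ⟨_, hk1 t⟩,
          Finset.mem_univ _⟩, hk1 t, hk2 t, hk3 t, hk4 t⟩
    · rintro (⟨x, l⟩ | t) hf (⟨y, m⟩ | s) hf' heq
      · simp only [Sum.elim_inl, Prod.mk.injEq, add_left_inj] at heq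
        obtain ⟨h1, rfl⟩ := heq
        simpa using h1
      · simp only [Sum.elim_inl, Sum.elim_inr, Prod.mk.injEq] at heq
        have hf := (Finset.mem_filter.1 (Finset.inl_mem_disjSum.1 hf)).2
        exact absurd (hk5 s x l heq.1 heq.2) hf.2.2
      · simp only [Sum.elim_inl, Sum.elim_inr, Prod.mk.injEq] at heq
        have hf' := (Finset.mem_filter.1 (Finset.inl_mem_disjSum.1 hf')).2
        exact absurd (hk5 t y m heq.1.symm heq.2.symm) hf'.2.2
      · simp only [Sum.elim_inr, Prod.mk.injEq] at heq
        congr 1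
        rcases hw t with ht | ht <;> rcases hw s with hs | hs <;> rw [ht, hs] at heq
        · exact hA heq.1
        · exact absurd heq.1 (hAB _ _)
        · exact absurd heq.1.symm (hAB _ _)
        · exact hB heq.1
  -- With `b` gaps, `hχ`, `h1` and `h2` bound the number of uncovered flags by `3 * b + 6`. In `h3`
  -- the notches cancel against wide gaps by `h4` and `h7`, and each tooth leaves `1 + 1 + 2` from
  -- `h7`, `h6` and `h5`.
  omega

/-! ### Tiles as pairs of triangles -/

/-- The common side of the two unit triangles of a tile. -/
def Lozenge.diag (t : Lozenge) : (ℤ × ℤ) × Fin 3 :=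
  ![(t.base + (1, 0), 2), (t.base + (-1, 1), 0), (t.base, 1)] t.kind

/-- The two unit triangles of a tile. -/
def Lozenge.triangles (t : Lozenge) : Finset Triangle := {upAt t.diag, downAt t.diag}

theorem covers_iff {t : Lozenge} {δ : Triangle} : Covers t δ ↔ δ ∈ t.triangles := by
  obtain ⟨⟨x, y⟩, k⟩ := t
  obtain ⟨⟨a, b⟩, c⟩ := δ
  cases c <;> fin_cases k <;>
    simp [Covers, vertices_true, vertices_false, Lozenge.vertices, Lozenge.triangles, Lozenge.diag,
      upAt, downAt, step, Finset.insert_subset_iff] <;> omega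

theorem card_triangles (t : Lozenge) : t.triangles.card = 2 :=
  Finset.card_pair (by simp [upAt, downAt])

theorem verts_triangles (t : Lozenge) : verts t.triangles = t.vertices := by
  obtain ⟨⟨x, y⟩, k⟩ := t
  fin_cases k <;> ext ⟨a, b⟩ <;>
    simp [verts, vertices_true, vertices_false, Lozenge.vertices, Lozenge.triangles, Lozenge.diag,
      upAt, downAt, step] <;> omega

theorem edges_triangles (t : Lozenge) : edges t.triangles = insert t.diag t.sides := by
  obtain ⟨⟨x, y⟩, k⟩ := t
  fin_cases k <;> ext ⟨⟨a, b⟩, d⟩ <;> fin_cases d <;>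
    simp [edges, edges_true, edges_false, Lozenge.sides, Lozenge.triangles, Lozenge.diag,
      upAt, downAt, step] <;> omega

theorem diag_notMem_sides (t : Lozenge) : t.diag ∉ t.sides := by
  obtain ⟨⟨x, y⟩, k⟩ := t
  fin_cases k <;> simp [Lozenge.sides, Lozenge.diag, step]

theorem card_sides (t : Lozenge) : t.sides.card = 4 := by
  obtain ⟨⟨x, y⟩, k⟩ := t
  fin_cases k <;> simp [Lozenge.sides, step]

theorem card_lozenge_vertices (t : Lozenge) : t.vertices.card = 4 := by
  obtain ⟨⟨x, y⟩, k⟩ := t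
  fin_cases k <;> simp [Lozenge.vertices, step]

theorem ends_mem_lozenge_vertices {t : Lozenge} {e : (ℤ × ℤ) × Fin 3} (he : e ∈ t.sides) :
    e.1 ∈ t.vertices ∧ tip e ∈ t.vertices ∧ e.1 ≠ tip e := by
  obtain ⟨⟨x, y⟩, k⟩ := t
  obtain ⟨⟨a, b⟩, d⟩ := e
  fin_cases k <;> fin_cases d <;> simp [Lozenge.sides, Lozenge.vertices, step, tip] at he ⊢ <;>
    omega

/-- Two different sides determine a tile. -/
theorem eq_of_sides {s t : Lozenge} {e f : (ℤ × ℤ) × Fin 3} (hef : e ≠ f) (h1 : e ∈ s.sides)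
    (h2 : f ∈ s.sides) (h3 : e ∈ t.sides) (h4 : f ∈ t.sides) : s = t := by
  obtain ⟨⟨x, y⟩, k⟩ := s
  obtain ⟨⟨z, w⟩, l⟩ := t
  obtain ⟨⟨a, b⟩, d⟩ := e
  obtain ⟨⟨a', b'⟩, d'⟩ := f
  fin_cases k <;> fin_cases l <;> fin_cases d <;> fin_cases d' <;>
    simp [Lozenge.sides, step] at h1 h2 h3 h4 hef ⊢ <;> omega

theorem exists_tooth_of {C : Finset Triangle} {V : Finset (ℤ × ℤ)} (A B : ℤ × ℤ) (j : Fin 6)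
    (hA : A ∈ V) (hB : B ∈ V) (h1 : ∀ i, sector A i ∈ C ↔ i = j)
    (h2 : (B = A + unitVec j ∧ ∀ i, sector B i ∈ C ↔ i = j + 1 ∨ i = j + 2) ∨
      (B = A + unitVec (j + 1) ∧ ∀ i, sector B i ∈ C ↔ i = j + 4 ∨ i = j + 5)) :
    ∃ A B j, IsTooth C A B j ∧ A ∈ V ∧ B ∈ V :=
  ⟨A, B, j, ⟨h1, h2⟩, hA, hB⟩

/-- The two corners of a tile off a given side. -/
theorem exists_tooth_triangles {t : Lozenge} {e : (ℤ × ℤ) × Fin 3} (he : e ∈ t.sides) :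
    ∃ A B j, IsTooth t.triangles A B j ∧ A ∈ t.vertices \ {e.1, tip e} ∧
      B ∈ t.vertices \ {e.1, tip e} := by
  obtain ⟨⟨x, y⟩, k⟩ := t
  fin_cases k <;> simp [Lozenge.sides, step] at he <;> rcases he with rfl | rfl | rfl | rfl
  -- Three kinds of tile with four sides each. The cases are treated from the last one on, since
  -- every `refine` opens several goals and would shift the later numbers.
  on_goal 12 => refine exists_tooth_of (x + 1, y + 0) (x + 0, y + 0) 2 ?_ ?_ ?_ ?_
  on_goal 11 => refine exists_tooth_of (x + -1, y + 1) (x + 0, y + 1) 5 ?_ ?_ ?_ ?_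
  on_goal 10 => refine exists_tooth_of (x + -1, y + 1) (x + 0, y + 0) 5 ?_ ?_ ?_ ?_
  on_goal 9 => refine exists_tooth_of (x + 1, y + 0) (x + 0, y + 1) 2 ?_ ?_ ?_ ?_
  on_goal 8 => refine exists_tooth_of (x + 0, y + 0) (x + -1, y + 1) 1 ?_ ?_ ?_ ?_
  on_goal 7 => refine exists_tooth_of (x + -1, y + 2) (x + 0, y + 1) 4 ?_ ?_ ?_ ?_
  on_goal 6 => refine exists_tooth_of (x + 0, y + 0) (x + 0, y + 1) 1 ?_ ?_ ?_ ?_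
  on_goal 5 => refine exists_tooth_of (x + -1, y + 2) (x + -1, y + 1) 4 ?_ ?_ ?_ ?_
  on_goal 4 => refine exists_tooth_of (x + 0, y + 0) (x + 0, y + 1) 0 ?_ ?_ ?_ ?_
  on_goal 3 => refine exists_tooth_of (x + 1, y + 1) (x + 1, y + 0) 3 ?_ ?_ ?_ ?_
  on_goal 2 => refine exists_tooth_of (x + 0, y + 0) (x + 1, y + 0) 0 ?_ ?_ ?_ ?_
  on_goal 1 => refine exists_tooth_of (x + 1, y + 1) (x + 0, y + 1) 3 ?_ ?_ ?_ ?_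
  all_goals
    first
    | simp [Lozenge.vertices, tip, step] <;> omega
    | intro i
      fin_cases i <;> simp [sector, Lozenge.triangles, Lozenge.diag, upAt, downAt] <;> omega
    | refine Or.inl (And.intro ?_ fun i => ?_)
      · simp [unitVec] <;> omega
      · fin_cases i <;> simp [sector, Lozenge.triangles, Lozenge.diag, upAt, downAt]
    | refine Or.inr (And.intro ?_ fun i => ?_)
      · simp [unitVec] <;> omega
      · fin_cases i <;> simp [sector, Lozenge.triangles, Lozenge.diag, upAt, downAt]

/-- The unit triangles covered by a set of tiles. -/
def area (T : Finset Lozenge) : Finset Triangle := T.biUnion Lozenge.triangles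

/-- The tiles of `T` do not overlap. -/
def IsPacking (T : Finset Lozenge) : Prop :=
  ∀ s ∈ T, ∀ t ∈ T, ∀ δ ∈ s.triangles, δ ∈ t.triangles → s = t

theorem IsDokuTiling.isPacking {κ : ℕ} {T : Finset Lozenge} (hT : IsDokuTiling κ T) :
    IsPacking T :=
  fun s hs t ht δ h1 h2 => hT.nonoverlapping s hs t ht δ (covers_iff.2 h1) (covers_iff.2 h2)

theorem IsPacking.subset {S T : Finset Lozenge} (hT : IsPacking T) (h : S ⊆ T) : IsPacking S :=
  fun s hs t ht => hT s (h hs) t (h ht)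

theorem mem_verts_area {T : Finset Lozenge} {v : ℤ × ℤ} :
    v ∈ verts (area T) ↔ ∃ t ∈ T, v ∈ t.vertices := by
  simp only [verts, area, Finset.biUnion_biUnion]
  simp only [Finset.mem_biUnion, ← verts_triangles, verts]

theorem mem_edges_area {T : Finset Lozenge} {e : (ℤ × ℤ) × Fin 3} :
    e ∈ edges (area T) ↔ ∃ t ∈ T, e = t.diag ∨ e ∈ t.sides := by
  simp only [← Finset.mem_insert, ← edges_triangles]
  simp only [edges, area, Finset.biUnion_biUnion, Finset.mem_biUnion]

theorem IsPacking.card_area {T : Finset Lozenge} (hT : IsPacking T) :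
    (area T).card = 2 * T.card := by
  rw [area, Finset.card_biUnion, Finset.sum_congr rfl fun t _ => card_triangles t,
    Finset.sum_const, smul_eq_mul, mul_comm]
  intro s hs t ht hst
  exact Finset.disjoint_left.2 fun δ h1 h2 => hst (hT s hs t ht δ h1 h2)

theorem side_triangle {t : Lozenge} {e : (ℤ × ℤ) × Fin 3} (he : e ∈ t.sides) :
    upAt e ∈ t.triangles ∨ downAt e ∈ t.triangles := by
  rw [← mem_edges, edges_triangles]
  exact Finset.mem_insert_of_mem he

theorem IsPacking.side_ne_diag {T : Finset Lozenge} (hT : IsPacking T) {s t : Lozenge}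
    (hs : s ∈ T) (ht : t ∈ T) {e : (ℤ × ℤ) × Fin 3} (he : e ∈ s.sides) : e ≠ t.diag := by
  rintro rfl
  have h : s = t := by
    rcases side_triangle he with h | h
    · exact hT s hs t ht _ h (by simp [Lozenge.triangles])
    · exact hT s hs t ht _ h (by simp [Lozenge.triangles])
  subst h
  exact diag_notMem_sides _ he

/-- At most two tiles share a side. -/
theorem IsPacking.eq_or_eq_of_side {T : Finset Lozenge} (hT : IsPacking T) {r s t : Lozenge}
    (hr : r ∈ T) (hs : s ∈ T) (ht : t ∈ T) {e : (ℤ × ℤ) × Fin 3} (h1 : e ∈ r.sides)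
    (h2 : e ∈ s.sides) (h3 : e ∈ t.sides) (hst : s ≠ t) : r = s ∨ r = t := by
  rcases side_triangle h1 with h1 | h1 <;> rcases side_triangle h2 with h2 | h2 <;>
    rcases side_triangle h3 with h3 | h3
  · exact .inl (hT _ hr _ hs _ h1 h2)
  · exact .inl (hT _ hr _ hs _ h1 h2)
  · exact .inr (hT _ hr _ ht _ h1 h3)
  · exact absurd (hT _ hs _ ht _ h2 h3) hst
  · exact absurd (hT _ hs _ ht _ h2 h3) hst
  · exact .inr (hT _ hr _ ht _ h1 h3)
  · exact .inl (hT _ hr _ hs _ h1 h2)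
  · exact .inl (hT _ hr _ hs _ h1 h2)

/-- The sides of the tiles of `T`. -/
def allSides (T : Finset Lozenge) : Finset ((ℤ × ℤ) × Fin 3) := T.biUnion Lozenge.sides

/-- In a packing no diagonal is a side of a tile, and different tiles have different diagonals. -/
theorem IsPacking.card_edges_area {T : Finset Lozenge} (hT : IsPacking T) :
    (edges (area T)).card = T.card + (allSides T).card := by
  have h : edges (area T) = T.image Lozenge.diag ∪ allSides T := by
    ext e
    simp only [mem_edges_area, allSides, Finset.mem_union, Finset.mem_image, Finset.mem_biUnion]
    constructor
    · rintro ⟨t, ht, rfl | h⟩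
      exacts [.inl ⟨t, ht, rfl⟩, .inr ⟨t, ht, h⟩]
    · rintro (⟨t, ht, rfl⟩ | ⟨t, ht, h⟩)
      exacts [⟨t, ht, .inl rfl⟩, ⟨t, ht, .inr h⟩]
  rw [h, Finset.card_union_of_disjoint, Finset.card_image_of_injOn]
  · intro s hs t ht hst
    exact hT s hs t ht (upAt s.diag) (by simp [Lozenge.triangles])
      (by rw [show s.diag = t.diag from hst]; simp [Lozenge.triangles])
  · refine Finset.disjoint_left.2 fun e he he' => ?_
    obtain ⟨t, ht, rfl⟩ := Finset.mem_image.1 he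
    obtain ⟨s, hs, h⟩ := Finset.mem_biUnion.1 he'
    exact hT.side_ne_diag hs ht h rfl

theorem eqvGen_lozenge_vertices {T : Finset Lozenge} {t : Lozenge} (ht : t ∈ T) {a b : ℤ × ℤ}
    (ha : a ∈ t.vertices) (hb : b ∈ t.vertices) :
    EqvGen (Joined Prod.fst tip (edges (area T))) a b := by
  have sub : ∀ δ ∈ t.triangles, δ.edges ⊆ edges (area T) := fun δ hδ =>
    Finset.subset_biUnion_of_mem Triangle.edges (Finset.mem_biUnion.2 ⟨t, ht, hδ⟩)
  have key : ∀ c ∈ t.vertices, EqvGen (Joined Prod.fst tip (edges (area T))) t.diag.1 c := by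
    intro c hc
    rw [← verts_triangles] at hc
    obtain ⟨δ, hδ, hc⟩ := Finset.mem_biUnion.1 hc
    refine eqvGen_joined_mono (sub δ hδ) (eqvGen_of_mem_vertices ?_ hc)
    refine (ends_mem_vertices ?_).1
    rw [mem_edges_iff]
    simpa [Lozenge.triangles] using hδ
  exact (key a ha).symm.trans _ _ _ (key b hb)

/-- The Euler characteristic of a set of tiles connected through vertices is at most one. -/
theorem euler_le {T : Finset Lozenge} (h : (neighbourGraph T).Preconnected) :
    (verts (area T)).card + (area T).card ≤ (edges (area T)).card + 1 := by
  refine card_verts_add_card_le _ fun a ha b hb => ?_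
  obtain ⟨s, hs, ha⟩ := mem_verts_area.1 ha
  obtain ⟨t, ht, hb⟩ := mem_verts_area.1 hb
  have walk : ∀ x y : T, (neighbourGraph T).Reachable x y → ∀ a ∈ x.1.vertices,
      ∀ b ∈ y.1.vertices, EqvGen (Joined Prod.fst tip (edges (area T))) a b := by
    rintro x y ⟨w⟩
    induction w with
    | nil => exact fun a ha b hb => eqvGen_lozenge_vertices (Subtype.mem _) ha hb
    | @cons x z y hxz w ih =>
      intro a ha b hb
      rw [neighbourGraph, SimpleGraph.fromRel_adj] at hxz
      obtain ⟨p, hp1, hp2⟩ : ∃ p, p ∈ x.1.vertices ∧ p ∈ z.1.vertices := by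
        rcases hxz.2 with ⟨p, h1, h2⟩ | ⟨p, h1, h2⟩
        exacts [⟨p, h1, h2⟩, ⟨p, h2, h1⟩]
      exact (eqvGen_lozenge_vertices x.2 ha hp1).trans _ _ _ (ih p hp2 b hb)
  exact walk ⟨s, hs⟩ ⟨t, ht⟩ (h _ _) a ha b hb

theorem dualGraph_adj {T : Finset Lozenge} {s t : T} :
    (dualGraph T).Adj s t ↔ s ≠ t ∧ ∃ e, e ∈ s.1.sides ∧ e ∈ t.1.sides := by
  rw [dualGraph, SimpleGraph.fromRel_adj]
  simp only [and_comm (a := _ ∈ t.1.sides), or_self]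

theorem parallelGraph_adj {T : Finset Lozenge} {d : Fin 3} {s t : T} :
    (parallelGraph T d).Adj s t ↔ s ≠ t ∧ ∃ p, (p, d) ∈ s.1.sides ∧ (p, d) ∈ t.1.sides := by
  rw [parallelGraph, SimpleGraph.fromRel_adj]
  simp only [and_comm (a := _ ∈ t.1.sides), or_self]

/-! ### Removing a tile; leaves as teeth -/

section Tiling

variable {κ : ℕ} {T : Finset Lozenge}

theorem IsDokuTiling.preconnected_compl (hT : IsDokuTiling κ T) :
    (triangleGraph.induce {δ | δ ∉ area T}).Preconnected := by
  have h := hT.noHoles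
  have e : {δ | ∀ t ∈ T, ¬ Covers t δ} = {δ | δ ∉ area T} := by
    ext δ
    simp [area, covers_iff]
  rwa [NoHoles, e] at h

theorem IsDokuTiling.euler_le (hT : IsDokuTiling κ T) :
    (verts (area T)).card + (area T).card ≤ (edges (area T)).card + 1 := by
  refine Doku.euler_le (hT.connected.preconnected.mono ?_)
  intro s t hst
  obtain ⟨hne, e, h1, h2⟩ := dualGraph_adj.1 hst
  rw [neighbourGraph, SimpleGraph.fromRel_adj]
  exact ⟨hne, .inl ⟨e.1, (ends_mem_lozenge_vertices h1).1, (ends_mem_lozenge_vertices h2).1⟩⟩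

/-- Since a tile can be removed without disconnecting the tiling, it has almost as many corners as
sides of its own. -/
theorem IsDokuTiling.card_own_sides_le (hT : IsDokuTiling κ T) {s : Lozenge} (hs : s ∈ T) :
    (s.sides.filter fun e => ∀ t ∈ T, t ≠ s → e ∉ t.sides).card ≤
      (s.vertices.filter fun v => ∀ t ∈ T, t ≠ s → v ∉ t.vertices).card + 1 := by
  have hP := hT.isPacking
  -- The Euler characteristic is at most one without `s` and at least one with it. Putting `s` back
  -- adds two triangles, the diagonal, the own sides and at most the own corners of `s`; comparing
  -- gives the claim.
  have h1 := Doku.euler_le (hT.robust s hs)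
  have hne : (area T).Nonempty :=
    ⟨upAt s.diag, Finset.mem_biUnion.2 ⟨s, hs, by simp [Lozenge.triangles]⟩⟩
  have h2 := card_edges_lt (area T) hne hT.preconnected_compl
  rw [(hP.subset (Finset.erase_subset s T)).card_area, Finset.card_erase_of_mem hs] at h1
  rw [hP.card_area] at h2
  have h3 := Finset.card_pos.2 ⟨s, hs⟩
  have hV : verts (area T) ⊆ verts (area (T.erase s)) ∪
      s.vertices.filter fun v => ∀ t ∈ T, t ≠ s → v ∉ t.vertices := by
    intro v hv
    simp only [Finset.mem_union, mem_verts_area, Finset.mem_filter, Finset.mem_erase] at hv ⊢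
    obtain ⟨t, ht, hv⟩ := hv
    by_cases h : ∃ r ∈ T, r ≠ s ∧ v ∈ r.vertices
    · obtain ⟨r, hr, hrs, hv⟩ := h
      exact .inl ⟨r, ⟨hrs, hr⟩, hv⟩
    · push Not at h
      have : t = s := by
        by_contra hts
        exact h t ht hts hv
      exact .inr ⟨this ▸ hv, h⟩
  have hE : edges (area (T.erase s)) ∪ ({s.diag} ∪
      s.sides.filter fun e => ∀ t ∈ T, t ≠ s → e ∉ t.sides) ⊆ edges (area T) := by
    intro e he
    simp only [Finset.mem_union, mem_edges_area, Finset.mem_filter, Finset.mem_erase,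
      Finset.mem_singleton] at he ⊢
    rcases he with ⟨t, ht, h⟩ | rfl | h
    exacts [⟨t, ht.2, h⟩, ⟨s, hs, .inl rfl⟩, ⟨s, hs, .inr h.1⟩]
  have hE' := Finset.card_le_card hE
  rw [Finset.card_union_of_disjoint, Finset.card_union_of_disjoint, Finset.card_singleton] at hE'
  · have := (Finset.card_le_card hV).trans (Finset.card_union_le _ _)
    omega
  · rw [Finset.disjoint_singleton_left, Finset.mem_filter]
    exact fun h => diag_notMem_sides s h.1
  · refine Finset.disjoint_left.2 fun e he he' => ?_
    simp only [Finset.mem_union, mem_edges_area, Finset.mem_filter, Finset.mem_erase,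
      Finset.mem_singleton] at he he'
    obtain ⟨t, ⟨hts, ht⟩, h⟩ := he
    rcases he' with rfl | ⟨h5, h6⟩
    · rcases h with h | h
      · exact hts (hP t ht s hs (upAt s.diag) (by rw [h]; simp [Lozenge.triangles])
          (by simp [Lozenge.triangles]))
      · exact hP.side_ne_diag ht hs h rfl
    · rcases h with h | h
      · exact hP.side_ne_diag hs ht h5 h
      · exact h6 t ht hts h

/-- A leaf is a tooth of the tiling. -/
theorem IsDokuTiling.exists_isTooth (hT : IsDokuTiling κ T) {t : T} (ht : t ∈ leaves T) :
    ∃ A B j, IsTooth (area T) A B j ∧ (∀ s ∈ T, A ∈ s.vertices ↔ s = t) ∧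
      ∀ s ∈ T, B ∈ s.vertices ↔ s = t := by
  obtain ⟨u, hu, huniq⟩ := ht
  obtain ⟨htu, e, he1, he2⟩ := dualGraph_adj.1 hu
  -- A second side shared with `u` would force `t = u`, so the three sides other than `e` belong to
  -- `t` alone. Then `t` has at least two corners of its own, and they can only be the two off `e`.
  have hsides : t.1.sides.erase e ⊆
      t.1.sides.filter fun e => ∀ s ∈ T, s ≠ t.1 → e ∉ s.sides := by
    intro f hf
    rw [Finset.mem_erase] at hf
    refine Finset.mem_filter.2 ⟨hf.2, fun s hs hst hfs => ?_⟩
    have hsu : (⟨s, hs⟩ : T) = u :=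
      huniq _ (dualGraph_adj.2 ⟨fun h => hst (congrArg Subtype.val h).symm, f, hf.2, hfs⟩)
    refine htu (Subtype.ext (eq_of_sides hf.1 hf.2 he1 ?_ he2))
    rw [← hsu]
    exact hfs
  have hverts : t.1.vertices.filter (fun v => ∀ s ∈ T, s ≠ t.1 → v ∉ s.vertices) ⊆
      t.1.vertices \ {e.1, tip e} := by
    intro v hv
    rw [Finset.mem_filter] at hv
    refine Finset.mem_sdiff.2 ⟨hv.1, fun h => ?_⟩
    have hu' := hv.2 u.1 u.2 fun h => htu (Subtype.ext h.symm)
    have := ends_mem_lozenge_vertices he2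
    rw [Finset.mem_insert, Finset.mem_singleton] at h
    rcases h with rfl | rfl
    exacts [hu' this.1, hu' this.2.1]
  have h1 := Finset.card_le_card hsides
  rw [Finset.card_erase_of_mem he1, card_sides] at h1
  have h2 := hT.card_own_sides_le t.2
  have h3 : (t.1.vertices \ {e.1, tip e}).card = 2 := by
    have := ends_mem_lozenge_vertices he1
    rw [Finset.card_sdiff_of_subset, card_lozenge_vertices, Finset.card_pair this.2.2]
    intro v hv
    rw [Finset.mem_insert, Finset.mem_singleton] at hv
    rcases hv with rfl | rfl
    exacts [this.1, this.2.1]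
  have h4 := Finset.eq_of_subset_of_card_le hverts (by omega)
  obtain ⟨A, B, j, htooth, hA, hB⟩ := exists_tooth_triangles he1
  rw [← h4, Finset.mem_filter] at hA hB
  have own : ∀ v, (v ∈ t.1.vertices ∧ ∀ s ∈ T, s ≠ t.1 → v ∉ s.vertices) →
      (∀ s ∈ T, v ∈ s.vertices ↔ s = t) ∧
        ∀ i, sector v i ∈ area T ↔ sector v i ∈ t.1.triangles := by
    intro v hv
    have key : ∀ s ∈ T, v ∈ s.vertices → s = t := fun s hs h => by
      by_contra hst
      exact hv.2 s hs hst h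
    refine ⟨fun s hs => ⟨key s hs, fun h => h ▸ hv.1⟩, fun i => ?_⟩
    rw [area, Finset.mem_biUnion]
    refine ⟨fun ⟨s, hs, h⟩ => ?_, fun h => ⟨t, t.2, h⟩⟩
    have : v ∈ s.vertices := by
      rw [← verts_triangles, mem_verts]
      exact ⟨i, h⟩
    exact key s hs this ▸ h
  refine ⟨A, B, j, ?_, (own A hA).1, (own B hB).1⟩
  simpa only [IsTooth, (own A hA).2, (own B hB).2] using htooth

/-- The turning inequality for the tiling: with `2n` triangles and `n + |allSides|` segments, the
boundary has length `2 * |allSides| - 4n`. Different leaves have different corners `A` and `B`,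
since these belong to no other tile. -/
theorem IsDokuTiling.four_mul_ncard_leaves_le (hT : IsDokuTiling κ T) :
    4 * (leaves T).ncard + 4 * T.card ≤ 2 * (allSides T).card + 6 := by
  choose A B j h hA hB using fun t : leaves T => hT.exists_isTooth t.2
  have inj : ∀ f : leaves T → ℤ × ℤ, (∀ t : leaves T, ∀ s ∈ T, f t ∈ s.vertices ↔ s = t.1) →
      Function.Injective f := by
    intro f hf s t hst
    have := (hf s s.1 s.1.2).2 rfl
    rw [hst, hf t _ s.1.2] at this
    exact Subtype.ext (Subtype.ext this)
  have := Fintype.ofFinite (leaves T)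
  have key := four_mul_card_teeth_le hT.preconnected_compl hT.euler_le A B j h (inj A hA) (inj B hB)
  have h1 := two_mul_card_edges (area T)
  rw [hT.isPacking.card_edges_area, hT.isPacking.card_area] at h1
  rw [← Nat.card_eq_fintype_card, Nat.card_coe_set_eq] at key
  omega

end Tiling

/-! ### Shared sides, strips and runs -/

open scoped Classical in
/-- The sides which belong to two tiles. -/
noncomputable def sharedSides (T : Finset Lozenge) : Finset ((ℤ × ℤ) × Fin 3) :=
  (allSides T).filter fun e => ∃ s ∈ T, ∃ t ∈ T, s ≠ t ∧ e ∈ s.sides ∧ e ∈ t.sides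

/-- Double count of the incidences of tiles and sides: four per tile, at least two per shared side.
-/
theorem card_allSides_add_card_sharedSides_le (T : Finset Lozenge) :
    (allSides T).card + (sharedSides T).card ≤ 4 * T.card := by
  classical
  have h1 : ∑ t ∈ T, ((allSides T).filter fun e => e ∈ t.sides).card = 4 * T.card := by
    rw [mul_comm, ← smul_eq_mul, ← Finset.sum_const]
    refine Finset.sum_congr rfl fun t ht => ?_
    rw [← card_sides t]
    congr 1
    ext e
    simp only [allSides, Finset.mem_filter, Finset.mem_biUnion]
    exact ⟨fun h => h.2, fun h => ⟨⟨t, ht, h⟩, h⟩⟩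
  have h2 : ∑ t ∈ T, ((allSides T).filter fun e => e ∈ t.sides).card =
      ∑ e ∈ allSides T, (T.filter fun t => e ∈ t.sides).card := by
    simp only [Finset.card_filter]
    exact Finset.sum_comm
  rw [← h1, h2, sharedSides, Finset.card_filter, Finset.card_eq_sum_ones, ← Finset.sum_add_distrib]
  refine Finset.sum_le_sum fun e he => ?_
  obtain ⟨t, ht, het⟩ := Finset.mem_biUnion.1 he
  split_ifs with h
  · obtain ⟨s, hs, r, hr, hsr, h1, h2⟩ := h
    exact Finset.one_lt_card.2 ⟨s, Finset.mem_filter.2 ⟨hs, h1⟩, r, Finset.mem_filter.2 ⟨hr, h2⟩, hsr⟩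
  · exact Finset.card_pos.2 ⟨t, Finset.mem_filter.2 ⟨ht, het⟩⟩

open scoped Classical in
/-- A tile of `T` which contains a given unit triangle. -/
noncomputable def owner (T : Finset Lozenge) (δ : Triangle) : Lozenge :=
  if h : ∃ t ∈ T, δ ∈ t.triangles then h.choose else ⟨(0, 0), 0⟩

theorem IsPacking.owner_eq {T : Finset Lozenge} (hT : IsPacking T) {t : Lozenge} (ht : t ∈ T)
    {δ : Triangle} (hδ : δ ∈ t.triangles) : owner T δ = t := by
  have h : ∃ t ∈ T, δ ∈ t.triangles := ⟨t, ht, hδ⟩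
  rw [owner, dif_pos h]
  exact hT _ h.choose_spec.1 _ ht _ h.choose_spec.2 hδ

/-- The tiles linked to `t` by common sides of direction `d`. -/
def strip (T : Finset Lozenge) (d : Fin 3) (t : Lozenge) : Set Lozenge :=
  {x | ∃ (ht : t ∈ T) (hx : x ∈ T), (parallelGraph T d).Reachable ⟨t, ht⟩ ⟨x, hx⟩}

theorem mem_strip_self {T : Finset Lozenge} {d : Fin 3} {t : Lozenge} (ht : t ∈ T) :
    t ∈ strip T d t := ⟨ht, ht, SimpleGraph.Reachable.refl _⟩

theorem strip_eq_of_mem {T : Finset Lozenge} {d : Fin 3} {s t : Lozenge} (h : s ∈ strip T d t) :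
    strip T d s = strip T d t := by
  obtain ⟨ht, hs, h⟩ := h
  ext x
  constructor
  · rintro ⟨_, hx, h'⟩
    exact ⟨ht, hx, h.trans h'⟩
  · rintro ⟨_, hx, h'⟩
    exact ⟨hs, hx, h.symm.trans h'⟩

theorem strip_finite (T : Finset Lozenge) (d : Fin 3) (t : Lozenge) : (strip T d t).Finite :=
  T.finite_toSet.subset fun _ ⟨_, hx, _⟩ => hx

/-- A graph on the tiles in which a shared side joins the owners of its two triangles. Both
triangles at a shared side are covered, so the default value of `owner` plays no role. -/
theorem IsPacking.card_le_card_strips {T : Finset Lozenge} (hT : IsPacking T) (d : Fin 3)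
    [DecidableEq (Set Lozenge)] :
    T.card ≤ ((sharedSides T).filter fun e => e.2 = d).card + (T.image (strip T d)).card := by
  refine card_le_card_edges_add_card_classes _ (fun e => owner T (upAt e))
    (fun e => owner T (downAt e)) T (strip T d) fun a ha b hb hab => ?_
  have walk : ∀ x y : T, (parallelGraph T d).Reachable x y →
      EqvGen (Joined (fun e => owner T (upAt e)) (fun e => owner T (downAt e))
        ((sharedSides T).filter fun e => e.2 = d)) x.1 y.1 := by
    rintro x y ⟨w⟩
    induction w with
    | nil => exact EqvGen.refl _
    | @cons x z y hxz w ih =>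
      refine EqvGen.trans _ _ _ ?_ ih
      obtain ⟨hne, p, h1, h2⟩ := parallelGraph_adj.1 hxz
      have hne' : x.1 ≠ z.1 := fun h => hne (Subtype.ext h)
      have hmem : (p, d) ∈ (sharedSides T).filter fun e => e.2 = d := by
        refine Finset.mem_filter.2 ⟨Finset.mem_filter.2 ⟨Finset.mem_biUnion.2 ⟨x, x.2, h1⟩, ?_⟩, rfl⟩
        exact ⟨x, x.2, z, z.2, hne', h1, h2⟩
      have hr : EqvGen (Joined (fun e => owner T (upAt e)) (fun e => owner T (downAt e))
          ((sharedSides T).filter fun e => e.2 = d)) (owner T (upAt (p, d)))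
          (owner T (downAt (p, d))) := EqvGen.rel _ _ ⟨_, hmem, rfl, rfl⟩
      rcases side_triangle h1 with g1 | g1 <;> rcases side_triangle h2 with g2 | g2
      · exact absurd (hT _ x.2 _ z.2 _ g1 g2) hne'
      · rwa [hT.owner_eq x.2 g1, hT.owner_eq z.2 g2] at hr
      · rw [hT.owner_eq x.2 g1, hT.owner_eq z.2 g2] at hr
        exact hr.symm
      · exact absurd (hT _ x.2 _ z.2 _ g1 g2) hne'
  have hmem : b ∈ strip T d a := hab ▸ mem_strip_self hb
  obtain ⟨_, _, h⟩ := hmem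
  exact walk _ _ h

/-- A tile without neighbours across its sides of direction `d`. -/
def IsolatedAlong (T : Finset Lozenge) (d : Fin 3) (t : Lozenge) : Prop :=
  ∀ s ∈ T, s ≠ t → ∀ p, (p, d) ∈ t.sides → (p, d) ∉ s.sides

theorem strip_eq_singleton {T : Finset Lozenge} {d : Fin 3} {t : Lozenge} (ht : t ∈ T)
    (h : IsolatedAlong T d t) : strip T d t = {t} := by
  refine Set.eq_singleton_iff_unique_mem.2 ⟨mem_strip_self ht, ?_⟩
  rintro x ⟨_, hx, ⟨w⟩⟩
  cases w with
  | nil => rfl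
  | @cons _ z _ hz w =>
    obtain ⟨hne, p, h1, h2⟩ := parallelGraph_adj.1 hz
    exact absurd h2 (h z.1 z.2 (fun h => hne (Subtype.ext h.symm)) p h1)

theorem two_le_ncard_strip {T : Finset Lozenge} {d : Fin 3} {t : Lozenge} (ht : t ∈ T)
    (h : ¬ IsolatedAlong T d t) : 2 ≤ (strip T d t).ncard := by
  simp only [IsolatedAlong] at h
  push Not at h
  obtain ⟨s, hs, hst, p, h1, h2⟩ := h
  refine (Set.one_lt_ncard (strip_finite T d t)).2 ⟨t, mem_strip_self ht, s, ⟨ht, hs, ?_⟩, hst.symm⟩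
  refine SimpleGraph.Adj.reachable (parallelGraph_adj.2 ⟨?_, p, h1, h2⟩)
  exact fun h => hst (congrArg Subtype.val h).symm

theorem strip_mem_runs {T : Finset Lozenge} {d : Fin 3} {t : Lozenge} (ht : t ∈ T)
    (h : ¬ IsolatedAlong T d t) : strip T d t ∈ runs T := by
  refine ⟨two_le_ncard_strip ht h, d, (parallelGraph T d).connectedComponentMk ⟨t, ht⟩, ?_⟩
  ext x
  simp only [Set.mem_image, SimpleGraph.ConnectedComponent.mem_supp_iff,
    SimpleGraph.ConnectedComponent.eq, Subtype.exists, exists_and_right, exists_eq_right]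
  constructor
  · rintro ⟨_, hx, h⟩
    exact ⟨hx, h.symm⟩
  · rintro ⟨hx, h⟩
    exact ⟨ht, hx, h.symm⟩

/-- A coordinate which is constant along the direction `d`. -/
def height (d : Fin 3) (p : ℤ × ℤ) : ℤ := ![p.2, p.1, p.1 + p.2] d

theorem side_direction {t : Lozenge} {p : ℤ × ℤ} {d : Fin 3} (h : (p, d) ∈ t.sides) :
    d = t.kind ∨ d = t.kind + 1 := by
  simp only [Lozenge.sides, Finset.mem_insert, Finset.mem_singleton, Prod.mk.injEq] at h
  tauto

/-- Two tiles of the same kind with a common side of direction `d` are translates of each other by a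
unit step in their other direction `c`. -/
theorem height_of_common_side {s t : Lozenge} {p : ℤ × ℤ} {d c : Fin 3} (hk : s.kind = t.kind)
    (hst : s ≠ t) (h1 : (p, d) ∈ s.sides) (h2 : (p, d) ∈ t.sides) (hdc : d ≠ c)
    (hc : c = t.kind ∨ c = t.kind + 1) :
    height c s.base = height c t.base ∧ height d s.base ≠ height d t.base := by
  obtain ⟨⟨x, y⟩, k⟩ := s
  obtain ⟨⟨z, w⟩, l⟩ := t
  obtain ⟨a, b⟩ := p
  obtain rfl : k = l := hk
  fin_cases k <;> fin_cases d <;> fin_cases c <;>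
    simp [Lozenge.sides, step, height] at h1 h2 hst hdc hc ⊢ <;> omega

/-- Runs are sets of tiles, so a set which is a strip in two directions would be counted twice. Its
tiles would all have sides in both directions, hence be of one kind. Crossing sides of direction `c`
preserves `height d`, whereas crossing the side of direction `d` between `s` and a neighbour changes
it. -/
theorem strip_ne_strip {T : Finset Lozenge} {d c : Fin 3} (hdc : d ≠ c) {s t : Lozenge}
    (hs : s ∈ T) (h : ¬ IsolatedAlong T d s) : strip T d s ≠ strip T c t := by
  intro heq
  have hsc : s ∈ strip T c t := heq ▸ mem_strip_self hs
  rw [← strip_eq_of_mem hsc] at heq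
  have hcard := two_le_ncard_strip hs h
  have hdir : ∀ x ∈ strip T d s, x ∈ T ∧ ¬ IsolatedAlong T d x ∧ ¬ IsolatedAlong T c x := by
    intro x hx
    have hxT : x ∈ T := hx.2.1
    refine ⟨hxT, fun hi => ?_, fun hi => ?_⟩
    · rw [← strip_eq_of_mem hx, strip_eq_singleton hxT hi, Set.ncard_singleton] at hcard
      omega
    · rw [heq] at hx hcard
      rw [← strip_eq_of_mem hx, strip_eq_singleton hxT hi, Set.ncard_singleton] at hcard
      omega
  have hkinds : ∀ x ∈ strip T d s, (d = x.kind ∨ d = x.kind + 1) ∧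
      (c = x.kind ∨ c = x.kind + 1) := by
    intro x hx
    obtain ⟨-, h1, h2⟩ := hdir x hx
    simp only [IsolatedAlong] at h1 h2
    push Not at h1 h2
    obtain ⟨_, _, _, _, h1, _⟩ := h1
    obtain ⟨_, _, _, _, h2, _⟩ := h2
    exact ⟨side_direction h1, side_direction h2⟩
  have hkind : ∀ x ∈ strip T d s, ∀ y ∈ strip T d s, x.kind = y.kind := by
    intro x hx y hy
    have h1 := hkinds x hx
    have h2 := hkinds y hy
    have key : ∀ d c k l : Fin 3, d ≠ c → (d = k ∨ d = k + 1) ∧ (c = k ∨ c = k + 1) →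
        (d = l ∨ d = l + 1) ∧ (c = l ∨ c = l + 1) → k = l := by decide
    exact key d c _ _ hdc h1 h2
  have walk : ∀ x y : T, (parallelGraph T c).Reachable x y → x.1 ∈ strip T d s →
      height d x.1.base = height d y.1.base := by
    rintro x y ⟨w⟩
    induction w with
    | nil => exact fun _ => rfl
    | @cons x z y hxz w ih =>
      intro hx
      have hz : z.1 ∈ strip T d s := by
        rw [heq] at hx ⊢
        rw [← strip_eq_of_mem hx]
        exact ⟨x.2, z.2, hxz.reachable⟩
      obtain ⟨hne, p, h1, h2⟩ := parallelGraph_adj.1 hxz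
      rw [← ih hz]
      exact (height_of_common_side (hkind _ hx _ hz) (fun h => hne (Subtype.ext h)) h1 h2 hdc.symm
        (hkinds _ hz).1).1
  simp only [IsolatedAlong] at h
  push Not at h
  obtain ⟨r, hr, hrs, p, h1, h2⟩ := h
  have hmem : r ∈ strip T d s := by
    refine ⟨hs, hr, SimpleGraph.Adj.reachable (parallelGraph_adj.2 ⟨?_, p, h1, h2⟩)⟩
    exact fun h => hrs (congrArg Subtype.val h).symm
  have hs' := mem_strip_self (d := d) hs
  have hne := (height_of_common_side (hkind _ hs' _ hmem) hrs.symm h1 h2 hdc (hkinds _ hmem).2).2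
  rw [heq] at hmem
  obtain ⟨_, _, hreach⟩ := hmem
  exact hne (walk _ _ hreach hs')

theorem runs_finite (T : Finset Lozenge) : (runs T).Finite := by
  refine (T.finite_toSet.finite_subsets).subset ?_
  rintro R ⟨-, d, c, rfl⟩ x ⟨y, -, rfl⟩
  exact y.2

open scoped Classical in
/-- The strips with at least two tiles are runs, and the others are isolated tiles. -/
theorem sum_card_strips_le (T : Finset Lozenge) :
    ∑ d, (T.image (strip T d)).card ≤
      (runs T).ncard + ∑ d, (T.filter (IsolatedAlong T d)).card := by
  let A : Fin 3 → Finset (Set Lozenge) := fun d =>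
    (T.filter fun t => ¬ IsolatedAlong T d t).image (strip T d)
  have h1 : ∀ d, (T.image (strip T d)).card ≤
      (A d).card + (T.filter (IsolatedAlong T d)).card := by
    intro d
    have : T.image (strip T d) ⊆ A d ∪ (T.filter (IsolatedAlong T d)).image (strip T d) := by
      rw [← Finset.image_union, Finset.union_comm, Finset.filter_union_filter_not_eq]
    exact (Finset.card_le_card this).trans ((Finset.card_union_le _ _).trans
      (Nat.add_le_add_left Finset.card_image_le _))
  have h2 : ∑ d, (A d).card ≤ (runs T).ncard := by
    rw [← Finset.card_biUnion, ← Set.ncard_coe_finset]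
    · refine Set.ncard_le_ncard ?_ (runs_finite T)
      intro R hR
      simp only [A, Finset.coe_biUnion, Set.mem_iUnion, Finset.coe_image, Set.mem_image,
        Finset.coe_filter] at hR
      obtain ⟨d, -, t, ht, rfl⟩ := hR
      exact strip_mem_runs ht.1 ht.2
    · intro d _ c _ hdc
      refine Finset.disjoint_left.2 fun R hR hR' => ?_
      simp only [A, Finset.mem_image, Finset.mem_filter] at hR hR'
      obtain ⟨s, hs, rfl⟩ := hR
      obtain ⟨t, ht, h⟩ := hR'
      exact strip_ne_strip hdc hs.1 hs.2 h.symm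
  have := Finset.sum_le_sum fun d (_ : d ∈ Finset.univ) => h1 d
  rw [Finset.sum_add_distrib] at this
  omega

/-! ### Isolated tiles and leaves -/

theorem mem_vertices_of_parallel_sides {t : Lozenge} {e f : (ℤ × ℤ) × Fin 3} (he : e ∈ t.sides)
    (hf : f ∈ t.sides) (hd : e.2 = f.2) (hne : e ≠ f) {v : ℤ × ℤ} (hv : v ∈ t.vertices) :
    v = e.1 ∨ v = tip e ∨ v = f.1 ∨ v = tip f := by
  obtain ⟨⟨x, y⟩, k⟩ := t
  obtain ⟨⟨a, b⟩, d⟩ := e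
  obtain ⟨⟨a', b'⟩, d'⟩ := f
  obtain ⟨v, w⟩ := v
  obtain rfl : d = d' := hd
  fin_cases k <;> fin_cases d <;>
    simp [Lozenge.sides, Lozenge.vertices, step, tip] at he hf hne hv ⊢ <;>
    rcases he with he | he <;> rcases hf with hf | hf <;> rcases hv with hv | hv | hv | hv <;>
    omega

theorem exists_two_sides {t : Lozenge} {d : Fin 3} (hd : d = t.kind ∨ d = t.kind + 1) :
    2 ≤ (t.sides.filter fun e => e.2 = d).card := by
  obtain ⟨⟨x, y⟩, k⟩ := t
  refine Finset.one_lt_card.2 ?_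
  simp only at hd
  rcases hd with hd | hd <;> subst hd
  · refine ⟨((x, y), d), by simp [Lozenge.sides], ((x, y) + step (d + 1), d),
      by simp [Lozenge.sides], ?_⟩
    fin_cases d <;> simp [step]
  · refine ⟨((x, y), k + 1), by simp [Lozenge.sides], ((x, y) + step k, k + 1),
      by simp [Lozenge.sides], ?_⟩
    fin_cases k <;> simp [step]

/-- A tile isolated along one of its two directions is a leaf. -/
theorem IsDokuTiling.mem_leaves {κ : ℕ} {T : Finset Lozenge} (hT : IsDokuTiling κ T)
    (hT2 : 2 ≤ T.card) {t : T} {d : Fin 3} (hd : d = t.1.kind ∨ d = t.1.kind + 1)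
    (hi : IsolatedAlong T d t.1) : t ∈ leaves T ∧ ∃ c, c ≠ d ∧ ¬ IsolatedAlong T c t.1 := by
  have hnt : Nontrivial T := by
    obtain ⟨s, hs, r, hr, h⟩ := Finset.one_lt_card.1 hT2
    exact ⟨⟨s, hs⟩, ⟨r, hr⟩, fun h' => h (congrArg Subtype.val h')⟩
  obtain ⟨u, hu⟩ := hT.connected.preconnected.exists_adj_of_nontrivial t
  have hdir : ∀ s : T, (dualGraph T).Adj t s → ∃ p c, c ≠ d ∧ (p, c) ∈ t.1.sides ∧
      (p, c) ∈ s.1.sides := by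
    intro s hs
    obtain ⟨hne, ⟨p, c⟩, h1, h2⟩ := dualGraph_adj.1 hs
    refine ⟨p, c, ?_, h1, h2⟩
    rintro rfl
    exact hi s.1 s.2 (fun h => hne (Subtype.ext h.symm)) p h1 h2
  obtain ⟨p, c, hcd, h1, h2⟩ := hdir u hu
  have htu := (dualGraph_adj.1 hu).1
  refine ⟨⟨u, hu, fun s hs => ?_⟩, c, hcd, fun hic =>
    hic u.1 u.2 (fun h => htu (Subtype.ext h.symm)) p h1 h2⟩
  by_contra hsu
  obtain ⟨q, c', hcd', g1, g2⟩ := hdir s hs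
  have hts := (dualGraph_adj.1 hs).1
  have hcc : c' = c := by
    have key : ∀ k d c c' : Fin 3, (d = k ∨ d = k + 1) → c ≠ d → c' ≠ d → (c = k ∨ c = k + 1) →
        (c' = k ∨ c' = k + 1) → c' = c := by decide
    exact key _ _ _ _ hd hcd hcd' (side_direction h1) (side_direction g1)
  subst hcc
  -- A side lies in at most two tiles, so the two neighbours `u` and `s` sit at opposite sides of
  -- `t`. Between them they touch all four corners, while the two sides of direction `d` belong to
  -- `t` alone: this violates the bound on own sides.
  have hpq : ((p, c') : (ℤ × ℤ) × Fin 3) ≠ (q, c') := by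
    intro h
    rw [← h] at g2
    rcases hT.isPacking.eq_or_eq_of_side t.2 u.2 s.2 h1 h2 g2
      (fun h => hsu (Subtype.ext h.symm)) with h | h
    exacts [htu (Subtype.ext h), hts (Subtype.ext h)]
  have hJ := hT.card_own_sides_le t.2
  have hS := exists_two_sides hd
  have hsub : (t.1.sides.filter fun e => e.2 = d) ⊆
      t.1.sides.filter fun e => ∀ s ∈ T, s ≠ t.1 → e ∉ s.sides := by
    rintro ⟨r, d'⟩ he
    obtain ⟨he1, rfl⟩ := Finset.mem_filter.1 he
    exact Finset.mem_filter.2 ⟨he1, fun s hs hst => hi s hs hst r he1⟩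
  have hV : (t.1.vertices.filter fun v => ∀ s ∈ T, s ≠ t.1 → v ∉ s.vertices) = ∅ := by
    refine Finset.filter_eq_empty_iff.2 fun v hv hown => ?_
    have hu' := hown u.1 u.2 fun h => htu (Subtype.ext h.symm)
    have hs' := hown s.1 s.2 fun h => hts (Subtype.ext h.symm)
    have e1 := ends_mem_lozenge_vertices h2
    have e2 := ends_mem_lozenge_vertices g2
    rcases mem_vertices_of_parallel_sides h1 g1 rfl hpq hv with rfl | rfl | rfl | rfl
    exacts [hu' e1.1, hu' e1.2.1, hs' e2.1, hs' e2.2.1]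
  have := Finset.card_le_card hsub
  rw [hV, Finset.card_empty] at hJ
  omega

open scoped Classical in
-- Pairs of a direction and a tile isolated along it. The direction `t.kind + 2`, in which `t` has
-- no sides, gives one pair per tile; any other pair makes the tile a leaf, and a leaf has only one
-- such pair, because its neighbour lies across its other direction.
theorem IsDokuTiling.sum_card_isolated_le {κ : ℕ} {T : Finset Lozenge} (hT : IsDokuTiling κ T)
    (hT2 : 2 ≤ T.card) :
    ∑ d, (T.filter (IsolatedAlong T d)).card ≤ T.card + (leaves T).ncard := by
  rw [← Finset.card_sigma]
  have h1 : (Finset.univ.sigma fun d : Fin 3 => T.filter (IsolatedAlong T d)) ⊆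
      T.image (fun t => (⟨t.kind + 2, t⟩ : (_ : Fin 3) × Lozenge)) ∪
      (Finset.univ.sigma fun d : Fin 3 => T.filter (IsolatedAlong T d)).filter
        fun z => z.1 ≠ z.2.kind + 2 := by
    rintro ⟨d, t⟩ hz
    by_cases h : d = t.kind + 2
    · subst h
      exact Finset.mem_union_left _ (Finset.mem_image.2
        ⟨t, (Finset.mem_filter.1 (Finset.mem_sigma.1 hz).2).1, rfl⟩)
    · exact Finset.mem_union_right _ (Finset.mem_filter.2 ⟨hz, h⟩)
  have h2 := (Finset.card_le_card h1).trans (Finset.card_union_le _ _)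
  have h3 : ((Finset.univ.sigma fun d : Fin 3 => T.filter (IsolatedAlong T d)).filter
        fun z => z.1 ≠ z.2.kind + 2).card ≤ (leaves T).ncard := by
    have hdir : ∀ d k : Fin 3, d ≠ k + 2 → d = k ∨ d = k + 1 := by decide
    have hz : ∀ z ∈ (Finset.univ.sigma fun d : Fin 3 => T.filter (IsolatedAlong T d)).filter
        (fun z => z.1 ≠ z.2.kind + 2), (z.1 = z.2.kind ∨ z.1 = z.2.kind + 1) ∧
        z.2 ∈ T ∧ IsolatedAlong T z.1 z.2 := by
      intro z hz
      have hz' := Finset.mem_filter.1 hz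
      exact ⟨hdir _ _ hz'.2, Finset.mem_filter.1 (Finset.mem_sigma.1 hz'.1).2⟩
    rw [← Set.ncard_image_of_injective (leaves T) Subtype.val_injective, ← Set.ncard_coe_finset]
    refine Set.ncard_le_ncard_of_injOn Sigma.snd ?_ ?_
      (((Set.toFinite (leaves T)).image _))
    · intro z hzm
      obtain ⟨h1, h2, h3⟩ := hz z hzm
      exact ⟨⟨z.2, h2⟩, (hT.mem_leaves hT2 (t := ⟨z.2, h2⟩) h1 h3).1, rfl⟩
    · rintro ⟨d, t⟩ hd ⟨c, s⟩ hc hst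
      obtain rfl : t = s := hst
      obtain ⟨g1, g2, g3⟩ := hz _ hd
      obtain ⟨k1, k2, k3⟩ := hz _ hc
      simp only at g1 g2 g3 k1 k2 k3
      by_contra hne
      have hdc : d ≠ c := fun h => hne (by rw [h])
      obtain ⟨-, b, hb, hb'⟩ := hT.mem_leaves hT2 (t := ⟨t, g2⟩) g1 g3
      simp only [IsolatedAlong] at hb'
      push Not at hb'
      obtain ⟨r, hr, hrt, p, e1, e2⟩ := hb'
      have key : ∀ k d c b : Fin 3, (d = k ∨ d = k + 1) → (c = k ∨ c = k + 1) → d ≠ c → b ≠ d →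
          (b = k ∨ b = k + 1) → b = c := by decide
      obtain rfl := key _ _ _ _ g1 k1 hdc hb (side_direction e1)
      exact k3 r hr hrt p e1 e2
  have h4 : (T.image (fun t => (⟨t.kind + 2, t⟩ : (_ : Fin 3) × Lozenge))).card ≤ T.card :=
    Finset.card_image_le
  omega

end Doku

theorem mainTheorem5 (κ : ℕ) (T : Finset Doku.Lozenge) (hT : Doku.IsDokuTiling κ T) :
    (Doku.leaves T).ncard ≤ (Doku.runs T).ncard + 3 := by
  classical
  rcases Set.eq_empty_or_nonempty (Doku.leaves T) with h | ⟨t, s, hs, -⟩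
  -- Without leaves the bound is trivial; a leaf provides the second tile needed for `mem_leaves`.
  · simp [h]
  have hT2 : 2 ≤ T.card := Finset.one_lt_card.2 ⟨t.1, t.2, s.1, s.2, fun h => hs.ne (Subtype.ext h)⟩
  have h1 := hT.four_mul_ncard_leaves_le
  have h2 := Doku.card_allSides_add_card_sharedSides_le T
  have h3 := Doku.sum_card_strips_le T
  have h4 := hT.sum_card_isolated_le hT2
  have h5 := Finset.sum_le_sum fun d (_ : d ∈ Finset.univ) => hT.isPacking.card_le_card_strips d
  rw [Finset.sum_add_distrib, Finset.sum_const, Finset.card_univ, Fintype.card_fin, smul_eq_mul,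
    ← Finset.card_eq_sum_card_fiberwise (fun _ _ => Finset.mem_univ _)] at h5
  have e : (∑ d, (T.image (Doku.strip T d)).card) ≤ (Doku.runs T).ncard +
    (T.card + (Doku.leaves T).ncard) := by
    refine le_trans ?_ (h3.trans (Nat.add_le_add_left h4 _))
    exact le_of_eq (Finset.sum_congr rfl fun d _ => by congr)
  have h6 : 3 * T.card ≤ (Doku.sharedSides T).card + ((Doku.runs T).ncard +
    (T.card + (Doku.leaves T).ncard)) := h5.trans (Nat.add_le_add_left e _)
  -- By `h1` and `h2`, `2ℓ ≤ 2n - σ + 3`; by `h6`, `2n - σ ≤ ρ + ℓ`.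
  omega
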